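/- Let $n\ge 1$ and let $t_1,\dots,t_n\in\mathbb R$ with $t_n\neq 0$ be the hopping strengths of an infinite chain with hopping range $n$. Let $\epsilon(k)=-2\sum_{m=1}^n t_m\cos(mk)$, $k\in[-\pi,\pi]$, be its dispersion relation, and let $\nu(\omega)=\int_{-\pi}^{\pi}\frac{dk}{2\pi}\,\delta(\omega-\epsilon(k))=D'(\omega)$ be its density of states, where $D(E)=\frac1{2\pi}\,|\{k\in[-\pi,\pi]:\epsilon(k)\le E\}|$. Let $\mathbf T(\omega)$ be the $2n\times 2n$ transfer matrix: $\mathbf T_{j+1,j}=1$ for $1\le j\le 2n-1$; $\mathbf T_{1,j}=-t_{n-j}/t_n$ for $1\le j\le n-1$; $\mathbf T_{1,n}=-\omega/t_n$; $\mathbf T_{1,j}=-t_{j-n}/t_n$ for $n+1\le j\le 2n$; all other entries are $0$. An exceptional point (EP) of order $p\ge 2$ of $\mathbf T(\omega_0)$ is an eigenvalue of algebraic multiplicity $p$ with a one-dimensional eigenspace; it occurs at the real momentum $k$ if the eigenvalue is $e^{-ik}$. Let $c(\omega)$ be the number of eigenvalues of $\mathbf T(\omega)$ of modulus $1$, counted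 with multiplicity. (i) (a) For given $n$, the integers $p$ that are the order of an EP of $\mathbf T(\omega_0)$ at an eigenvalue of modulus $1$, for some real $\omega_0,t_1,\dots,t_n$ with $t_n\ne0$, are exactly the integers $2,\dots,n$ and the even integers $p$ with $n<p\le 2n$. (b) An EP of order $p>n$ at a real momentum $k_0\in[-\pi,\pi]$ can occur only at $k_0\in\{0,\pi,-\pi\}$. (ii) Let $\mathbf T(\omega_0)$ have an EP of order $p$ at $k_0\in[-\pi,\pi]$, and suppose that all EPs of $\mathbf T(\omega_0)$ at real momenta in $[-\pi,\pi]$ have the same order $p$ and are of the same kind, i.e. either all or none of them are local minima of $\epsilon$ (this holds in particular if there are no EPs at momenta other than $\pm k_0$). Then $\operatorname{sign}[c(\omega_0+\delta)-c(\omega_0-\delta)]$ has a constant value $\mathcal I$ for all sufficiently small $\delta>0$, and either $p$ is even and $\mathcal I=\pm1$, or $p$ is odd and $\mathcal I=0$. Write $\nu(\omega_0\pm\delta)\propto\delta^{-(p-1)/p}$ if $\nu(\omega_0\pm\delta)$ exists for all small $\delta>0$ and $\nu(\omega_0\pm\delta)/\delta^{-(p-1)/p}$ has a finite positive limit as $\delta\to0^+$.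 Then: (a) the following are equivalent: $p$ is even and $\mathcal I=1$; $k_0$ is a local minimum of $\epsilon$; $\nu(\omega_0+\delta)\propto\delta^{-(p-1)/p}$ while $\nu(\omega_0-\delta)$ exists for small $\delta>0$ and has a finite limit as $\delta\to0^+$; (b) the following are equivalent: $p$ is even and $\mathcal I=-1$; $k_0$ is a local maximum of $\epsilon$; $\nu(\omega_0-\delta)\propto\delta^{-(p-1)/p}$ while $\nu(\omega_0+\delta)$ exists for small $\delta>0$ and has a finite limit as $\delta\to0^+$; (c) the following are equivalent: $p$ is odd; $\mathcal I=0$; $k_0$ is a saddle point of $\epsilon$ (a critical point that is not a local extremum); $\nu(\omega_0+\delta)\propto\delta^{-(p-1)/p}$ and $\nu(\omega_0-\delta)\propto\delta^{-(p-1)/p}$. -/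

import Mathlib

open Filter Topology

noncomputable section

/-- Dispersion relation `ε(k) = -2 ∑_{m=1}^n t_m cos (m k)` of the chain with real hopping strengths
`t 1, …, t n` (other values of `t` are never used). -/
def dispersion (n : ℕ) (t : ℕ → ℝ) (k : ℝ) : ℝ :=
  -2 * ∑ m ∈ Finset.Icc 1 n, t m * Real.cos (m * k)

/-- The `2n × 2n` transfer matrix `T(ω)` (real entries). Rows and columns are numbered from `0` here, so
that the column `j : Fin (2 * n)` is the `(j+1)`-st one. -/
def transferMatrix (n : ℕ) (t : ℕ → ℝ) (ω : ℝ) : Matrix (Fin (2 * n)) (Fin (2 * n)) ℝ :=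
  Matrix.of fun i j =>
    if (i : ℕ) = 0 then
      if (j : ℕ) + 1 < n then -(t (n - (j + 1)) / t n)
      else if (j : ℕ) + 1 = n then -(ω / t n)
      else -(t ((j + 1) - n) / t n)
    else if (i : ℕ) = (j : ℕ) + 1 then 1 else 0

/-- The transfer matrix with its entries regarded as complex numbers. -/
def transferMatrixC (n : ℕ) (t : ℕ → ℝ) (ω : ℝ) : Matrix (Fin (2 * n)) (Fin (2 * n)) ℂ :=
  (transferMatrix n t ω).map Complex.ofReal

/-- The complex square matrix `M` has an exceptional point of order `p` at the eigenvalue `μ`: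
`μ` is a `p`-fold repeated eigenvalue, `p ≥ 2`, and the `p` corresponding eigenvectors have coalesced
into one (up to scaling). -/
def IsExceptionalPoint {d : ℕ} (M : Matrix (Fin d) (Fin d) ℂ) (μ : ℂ) (p : ℕ) : Prop :=
  2 ≤ p ∧ M.charpoly.rootMultiplicity μ = p ∧
    Module.finrank ℂ (Module.End.eigenspace (Matrix.toLin' M) μ) = 1

/-- `T(ω)` has an exceptional point of order `p` at the real momentum `k`,
i.e. at the unit-modulus eigenvalue `e^{-ik}`. -/
def IsEPAtMomentum (n : ℕ) (t : ℕ → ℝ) (ω k : ℝ) (p : ℕ) : Prop :=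
  IsExceptionalPoint (transferMatrixC n t ω) (Complex.exp (-(Complex.I * (k : ℂ)))) p

/-- `c(ω)`: the number of eigenvalues of `T(ω)` of modulus one, counted with algebraic multiplicity. -/
def unitModulusCount (n : ℕ) (t : ℕ → ℝ) (ω : ℝ) : ℕ :=
  (transferMatrixC n t ω).charpoly.roots.countP (fun μ : ℂ => ‖μ‖ = 1)

/-- `sign [c(ω₀ + δ) - c(ω₀ - δ)]`. -/
def transferIndex (n : ℕ) (t : ℕ → ℝ) (ω₀ δ : ℝ) : SignType :=
  SignType.sign ((unitModulusCount n t (ω₀ + δ) : ℤ) - (unitModulusCount n t (ω₀ - δ) : ℤ))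

/-- Integrated density of states `D(E) = ∫_{-π}^{π} dk/(2π) Θ(E - ε(k))`. -/
def integratedDOS (n : ℕ) (t : ℕ → ℝ) (E : ℝ) : ℝ :=
  (MeasureTheory.volume {k : ℝ | k ∈ Set.Icc (-Real.pi) Real.pi ∧ dispersion n t k ≤ E}).toReal
    / (2 * Real.pi)

/-- Density of states `ν(ω) = ∫_{-π}^{π} dk/(2π) δ(ω - ε(k)) = dD/dE (ω)`. -/
def densityOfStates (n : ℕ) (t : ℕ → ℝ) (ω : ℝ) : ℝ :=
  deriv (integratedDOS n t) ω

/-- With `σ = 1` (resp. `σ = -1`): `ν(ω₀ + σ δ) ∝ δ^{-(p-1)/p}` as `δ → 0⁺`, i.e. `ν` exists near `ω₀` on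
the upper (resp. lower) side and `ν(ω₀ + σ δ) / δ^{-(p-1)/p}` tends to a positive constant. -/
def DOSDiverges (n : ℕ) (t : ℕ → ℝ) (ω₀ : ℝ) (σ : ℝ) (p : ℕ) : Prop :=
  (∀ᶠ δ in 𝓝[>] (0 : ℝ), DifferentiableAt ℝ (integratedDOS n t) (ω₀ + σ * δ)) ∧
    ∃ C : ℝ, 0 < C ∧
      Tendsto (fun δ : ℝ => densityOfStates n t (ω₀ + σ * δ) / δ ^ (-((p : ℝ) - 1) / (p : ℝ)))
        (𝓝[>] (0 : ℝ)) (𝓝 C)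

/-- With `σ = 1` (resp. `σ = -1`): `ν` exists near `ω₀` on the upper (resp. lower) side and has a finite
limit when `ω₀` is approached from that side. -/
def DOSFinite (n : ℕ) (t : ℕ → ℝ) (ω₀ : ℝ) (σ : ℝ) : Prop :=
  (∀ᶠ δ in 𝓝[>] (0 : ℝ), DifferentiableAt ℝ (integratedDOS n t) (ω₀ + σ * δ)) ∧
    ∃ L : ℝ, Tendsto (fun δ : ℝ => densityOfStates n t (ω₀ + σ * δ)) (𝓝[>] (0 : ℝ)) (𝓝 L)

/-- `k` is a saddle point of `f`: a critical point that is not a local extremum. -/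
def IsSaddlePoint (f : ℝ → ℝ) (k : ℝ) : Prop :=
  HasDerivAt f 0 k ∧ ¬ IsLocalExtr f k

end

/-! Why it holds. `T(ω)` is a companion matrix. Multiplied by `t n`, its characteristic polynomial
is `ω X^n + ∑ t m (X^(n+m) + X^(n-m))`, which at `e^{-ik}` equals `e^{-ink} (ω - ε(k))`. Eigenspaces
of a companion matrix are lines, so an exceptional point is just a multiple root, and its order at
momentum `k` is the order of vanishing of `ε - ω₀` at `k` (`exists_leading_coeff`).

Part (i). A nonreal root and its conjugate have equal multiplicities with sum at most `2n`, so an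
order above `n` forces the eigenvalue `±1`. Since `ε` is even about `0` and `π`, the order there is
even. Conversely every real monic palindromic polynomial of degree `2n` is a characteristic
polynomial, and explicit products of quadratics realise all the allowed orders.

Part (ii). Near a zero `z` of order `m`, `ε - ω₀ ~ B (k - z)^m`. The two sides of `z` give two
monotone branches, each with a sign. For small `δ > 0` the level `ω₀ + sδ` is crossed exactly once
by each branch of sign `s` and nowhere else, so `c(ω₀ + sδ)` is the number of such branches. Each
contributes to `D` its inverse function `h`, with `h'(δ)` of size `δ^{-(m-1)/m}`; away from the
branches the sublevel set is constant (`exists_branches`). A zero of odd order has one branch of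
each sign, a zero of even order two of the sign of `B`. By hypothesis all multiple zeros have order
`p` and, for even `p`, the same sign of `B`; simple zeros cancel in the index and contribute only
finite terms to `ν`. This gives three mutually exclusive outcomes, whence the equivalences. -/

/-! ### Characteristic polynomial and eigenspaces of the transfer matrix. -/

open Polynomial in
/-- The characteristic matrix of a companion matrix with first row `r`. -/
theorem det_companion_charmatrix {R : Type*} [CommRing R] (r : ℕ → R) (d : ℕ) :
    (Matrix.of fun i j : Fin d => (if i = j then (X : R[X]) else 0) -
      C (if (i : ℕ) = 0 then r j else if (i : ℕ) = (j : ℕ) + 1 then 1 else 0)).det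
      = X ^ d - ∑ j ∈ Finset.range d, C (r j) * X ^ (d - 1 - j) := by
  induction d with
  | zero => simp
  | succ d ih =>
    have hsum : ∑ j ∈ Finset.range (d + 1), C (r j) * (X : R[X]) ^ (d + 1 - 1 - j)
        = X * (∑ j ∈ Finset.range d, C (r j) * X ^ (d - 1 - j)) + C (r d) := by
      rw [Finset.sum_range_succ, Finset.mul_sum]
      congr 1
      · refine Finset.sum_congr rfl fun j hj => ?_
        rw [Finset.mem_range] at hj
        rw [show d + 1 - 1 - j = (d - 1 - j) + 1 by omega, pow_succ]
        ring
      · simp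
    rw [hsum]
    rcases d with _ | d
    · simp
    -- In the last column only the first and last rows are nonzero. The last row leaves the same
    -- matrix one size smaller. Size one is treated apart because there the two rows coincide.
    rw [Matrix.det_succ_column _ (Fin.last (d + 1))]
    rw [Fin.sum_univ_castSucc, Fin.sum_univ_succ]
    have hmid : ∀ i : Fin d, (Matrix.of fun i j : Fin (d + 1 + 1) =>
        (if i = j then (X : R[X]) else 0) -
        C (if (i : ℕ) = 0 then r j else if (i : ℕ) = (j : ℕ) + 1 then 1 else 0))
        i.succ.castSucc (Fin.last (d + 1)) = 0 := by
      intro i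
      have h1 : i.succ.castSucc ≠ Fin.last (d + 1) := (Fin.castSucc_lt_last _).ne
      have h2 : ¬ ((i : ℕ) + 1 = d + 1 + 1) := by omega
      rw [Matrix.of_apply, if_neg h1]
      simp
      omega
    rw [Finset.sum_eq_zero (fun i _ => by rw [hmid]; ring), add_zero]
    have hlast : (Matrix.of fun i j : Fin (d + 1 + 1) =>
        (if i = j then (X : R[X]) else 0) -
        C (if (i : ℕ) = 0 then r j else if (i : ℕ) = (j : ℕ) + 1 then 1 else 0)).submatrix
        (Fin.last (d + 1)).succAbove (Fin.last (d + 1)).succAbove =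
        (Matrix.of fun i j : Fin (d + 1) => (if i = j then (X : R[X]) else 0) -
        C (if (i : ℕ) = 0 then r j else if (i : ℕ) = (j : ℕ) + 1 then 1 else 0)) := by
      ext1 i j
      simp [Fin.succAbove_last]
    have hfirst : ((Matrix.of fun i j : Fin (d + 1 + 1) =>
        (if i = j then (X : R[X]) else 0) -
        C (if (i : ℕ) = 0 then r j else if (i : ℕ) = (j : ℕ) + 1 then 1 else 0)).submatrix
        (Fin.castSucc (0 : Fin (d + 1))).succAbove (Fin.last (d + 1)).succAbove).det
        = (-1) ^ (d + 1) := by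
      -- Deleting the first row and the last column moves the subdiagonal entries `-1` onto the
      -- diagonal.
      rw [Matrix.det_of_isUpperTriangular]
      · have : ∀ i : Fin (d + 1), ¬ (i.succ = i.castSucc) := fun i h => by
          simpa using congrArg Fin.val h
        simp [Fin.succAbove_last, this]
      · intro i j hij
        have hij' : (j : ℕ) < i := hij
        have h1 : i.succ ≠ j.castSucc := fun h => by
          have := congrArg Fin.val h
          simp at this
          omega
        simp [Fin.succAbove_last, h1]
        omega
    rw [hlast, hfirst, ih]
    have h0 : (Fin.castSucc (0 : Fin (d + 1))) ≠ Fin.last (d + 1) := (Fin.castSucc_lt_last _).ne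
    rw [Matrix.of_apply, Matrix.of_apply, if_neg h0]
    have hs : ((-1 : R[X]) ^ (d + 1)) * (-1) ^ (d + 1) = 1 := by
      rw [← mul_pow]; simp
    have hs2 : ((-1 : R[X]) ^ (d + 1 + (d + 1))) = 1 := by
      rw [pow_add, hs]
    simp [hs2]
    linear_combination (-C (r (d + 1))) * hs

-- The first row of a companion matrix lists, up to sign, the coefficients below the leading one.
-- Clearing the denominator `t n` shows their symmetry about degree `n`; the leading term supplies
-- the missing half of the summand `m = n`.
open Polynomial in
theorem charpoly_transferMatrixC (n : ℕ) (hn : 1 ≤ n) (t : ℕ → ℝ) (ht : t n ≠ 0) (ω : ℝ) :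
    C (t n : ℂ) * (transferMatrixC n t ω).charpoly
      = C (ω : ℂ) * X ^ n + ∑ m ∈ Finset.Icc 1 n, C (t m : ℂ) * (X ^ (n + m) + X ^ (n - m)) := by
  have htC : (t n : ℂ) ≠ 0 := by exact_mod_cast ht
  let r : ℕ → ℂ := fun j => if j + 1 < n then -(t (n - (j + 1)) / t n)
      else if j + 1 = n then -(ω / t n) else -(t ((j + 1) - n) / t n)
  have h1 : (transferMatrixC n t ω).charpoly
      = X ^ (2 * n) - ∑ j ∈ Finset.range (2 * n), C (r j) * X ^ (2 * n - 1 - j) := by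
    rw [← det_companion_charmatrix r, Matrix.charpoly]
    congr 1
    ext1 i j
    rw [Matrix.charmatrix_apply, Matrix.of_apply, Matrix.diagonal_apply]
    congr 2
    simp only [transferMatrixC, transferMatrix, Matrix.map_apply, Matrix.of_apply, r]
    split_ifs <;> push_cast <;> rfl
  obtain ⟨k, rfl⟩ : ∃ k, n = k + 1 := ⟨n - 1, by omega⟩
  rw [h1, show 2 * (k + 1) = k + 1 + (k + 1) by ring, Finset.sum_range_add, Finset.sum_range_succ]
  have hIcc : Finset.Icc 1 (k + 1) = Finset.Ico 1 (k + 1 + 1) := by ext; simp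
  rw [hIcc, Finset.sum_Ico_eq_sum_range]
  simp only [Nat.add_sub_cancel]
  rw [mul_sub, mul_add, mul_add, Finset.mul_sum, Finset.mul_sum]
  simp only [mul_add, Finset.sum_add_distrib]
  -- The columns before the `n`-th carry the powers above `X ^ n` in decreasing order, hence the
  -- reflected sum.
  have e1 : ∑ i ∈ Finset.range k, C (t (k + 1) : ℂ) * (C (r i) * X ^ (k + 1 + (k + 1) - 1 - i))
      = - ∑ i ∈ Finset.range k, C (t (1 + i) : ℂ) * X ^ (k + 1 + (1 + i)) := by
    rw [← Finset.sum_range_reflect, ← Finset.sum_neg_distrib]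
    refine Finset.sum_congr rfl fun i hi => ?_
    rw [Finset.mem_range] at hi
    have h2 : k - 1 - i + 1 < k + 1 := by omega
    rw [← mul_assoc, ← C_mul, ← neg_mul, ← C_neg]
    simp only [r, if_pos h2]
    rw [show k + 1 - (k - 1 - i + 1) = 1 + i by omega,
      show k + 1 + (k + 1) - 1 - (k - 1 - i) = k + 1 + (1 + i) by omega]
    congr 2
    field_simp
  have e2 : C (t (k + 1) : ℂ) * (C (r k) * X ^ (k + 1 + (k + 1) - 1 - k))
      = - (C (ω : ℂ) * X ^ (k + 1)) := by
    rw [← mul_assoc, ← C_mul, ← neg_mul, ← C_neg]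
    simp only [r]
    rw [show k + 1 + (k + 1) - 1 - k = k + 1 by omega]
    simp
    rw [← C_mul]
    congr 1
    field_simp
  have e3 : ∑ i ∈ Finset.range (k + 1), C (t (k + 1) : ℂ) *
        (C (r (k + 1 + i)) * X ^ (k + 1 + (k + 1) - 1 - (k + 1 + i)))
      = - ∑ i ∈ Finset.range (k + 1), C (t (1 + i) : ℂ) * X ^ (k + 1 - (1 + i)) := by
    rw [← Finset.sum_neg_distrib]
    refine Finset.sum_congr rfl fun i hi => ?_
    rw [Finset.mem_range] at hi
    rw [← mul_assoc, ← C_mul, ← neg_mul, ← C_neg]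
    have h2 : ¬ (k + 1 + i + 1 < k + 1) := by omega
    have h3 : ¬ (k + 1 + i + 1 = k + 1) := by omega
    simp only [r, if_neg h2, if_neg h3]
    rw [show k + 1 + i + 1 - (k + 1) = 1 + i by omega,
      show k + 1 + (k + 1) - 1 - (k + 1 + i) = k + 1 - (1 + i) by omega]
    congr 2
    field_simp
  rw [e1, e2, e3, Finset.sum_range_succ (fun i => C (t (1 + i) : ℂ) * X ^ (k + 1 + (1 + i)))]
  rw [show 1 + k = k + 1 by ring]
  ring

/-- On the unit circle the characteristic polynomial is `ω - ε(k)` up to a nonvanishing factor. -/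
theorem eval_charpoly_exp (n : ℕ) (hn : 1 ≤ n) (t : ℕ → ℝ) (ht : t n ≠ 0) (ω k : ℝ) :
    (t n : ℂ) * (transferMatrixC n t ω).charpoly.eval (Complex.exp (-(Complex.I * (k : ℂ))))
      = Complex.exp (-(Complex.I * (k : ℂ))) ^ n * ((ω - dispersion n t k : ℝ) : ℂ) := by
  have h := congrArg (Polynomial.eval (Complex.exp (-(Complex.I * (k : ℂ)))))
    (charpoly_transferMatrixC n hn t ht ω)
  rw [Polynomial.eval_mul, Polynomial.eval_C] at h
  rw [h]
  set μ := Complex.exp (-(Complex.I * (k : ℂ))) with hμ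
  simp only [dispersion, Polynomial.eval_add, Polynomial.eval_mul, Polynomial.eval_C,
    Polynomial.eval_pow, Polynomial.eval_X, Polynomial.eval_finsetSum]
  push_cast
  rw [mul_sub, mul_comm (ω : ℂ), sub_eq_add_neg, ← mul_neg, neg_mul, neg_neg, Finset.mul_sum,
    Finset.mul_sum]
  congr 1
  refine Finset.sum_congr rfl fun m hm => ?_
  rw [Finset.mem_Icc] at hm
  have hcos : 2 * Complex.cos (m * k) = μ ^ m + (μ ^ m)⁻¹ := by
    rw [Complex.two_cos, hμ, ← Complex.exp_nat_mul, ← Complex.exp_neg, add_comm]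
    congr 2 <;> ring
  have hμ0 : μ ≠ 0 := Complex.exp_ne_zero _
  have h2 : μ ^ (n - m) = μ ^ n * (μ ^ m)⁻¹ := by
    rw [pow_sub₀ _ hμ0 hm.2]
  rw [h2, pow_add]
  linear_combination (-(μ ^ n * t m)) * hcos

theorem eval_charpoly_exp_eq_zero_iff (n : ℕ) (hn : 1 ≤ n) (t : ℕ → ℝ) (ht : t n ≠ 0) (ω k : ℝ) :
    (transferMatrixC n t ω).charpoly.eval (Complex.exp (-(Complex.I * (k : ℂ)))) = 0
      ↔ dispersion n t k = ω := by
  have h := eval_charpoly_exp n hn t ht ω k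
  have htC : (t n : ℂ) ≠ 0 := by exact_mod_cast ht
  have hμ : Complex.exp (-(Complex.I * (k : ℂ))) ^ n ≠ 0 := pow_ne_zero _ (Complex.exp_ne_zero _)
  constructor
  · intro h0
    rw [h0, mul_zero, eq_comm, mul_eq_zero, or_iff_right hμ] at h
    have : ω - dispersion n t k = 0 := by exact_mod_cast h
    linarith
  · intro h0
    rw [h0, sub_self, Complex.ofReal_zero, mul_zero, mul_eq_zero, or_iff_right htC] at h
    exact h

/-- Eigenvectors of a companion matrix are determined by their last entry. -/
theorem finrank_eigenspace_transferMatrixC (n : ℕ) (hn : 1 ≤ n) (t : ℕ → ℝ) (ω : ℝ) (μ : ℂ)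
    (hμ : (transferMatrixC n t ω).charpoly.IsRoot μ) :
    Module.finrank ℂ (Module.End.eigenspace (Matrix.toLin' (transferMatrixC n t ω)) μ) = 1 := by
  set M := transferMatrixC n t ω with hM
  have hev : Module.End.HasEigenvalue (Matrix.toLin' M) μ := by
    rw [Module.End.hasEigenvalue_iff_isRoot_charpoly]
    simpa [Matrix.charpoly_toLin'] using hμ
  apply le_antisymm
  · let L : Module.End.eigenspace (Matrix.toLin' M) μ →ₗ[ℂ] ℂ :=
      (LinearMap.proj (⟨2 * n - 1, by omega⟩ : Fin (2 * n))).comp (Submodule.subtype _)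
    have hinj : Function.Injective L := by
      rw [injective_iff_map_eq_zero]
      rintro ⟨v, hv⟩ h0
      have h0' : v ⟨2 * n - 1, by omega⟩ = 0 := h0
      rw [Module.End.mem_eigenspace_iff, Matrix.toLin'_apply] at hv
      have hrec : ∀ j (hj : j + 1 < 2 * n), v ⟨j, by omega⟩ = μ * v ⟨j + 1, hj⟩ := by
        intro j hj
        have := congrFun hv ⟨j + 1, hj⟩
        rw [Pi.smul_apply, smul_eq_mul] at this
        rw [← this, Matrix.mulVec, dotProduct, Finset.sum_eq_single (⟨j, by omega⟩ : Fin (2 * n))]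
        · simp [hM, transferMatrixC, transferMatrix]
        · intro b _ hb
          have : ¬ (j = (b : ℕ)) := fun h => hb (Fin.ext h.symm)
          simp [hM, transferMatrixC, transferMatrix, this]
        · simp
      have hz : ∀ i j (hj : j < 2 * n), j + i = 2 * n - 1 → v ⟨j, hj⟩ = 0 := by
        intro i
        induction i with
        | zero =>
          intro j hj hji
          have : j = 2 * n - 1 := by omega
          subst this
          exact h0'
        | succ i ih =>
          intro j hj hji
          rw [hrec j (by omega), ih (j + 1) (by omega) (by omega), mul_zero]
      ext ⟨j, hj⟩
      exact hz (2 * n - 1 - j) j hj (by omega)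
    simpa using LinearMap.finrank_le_finrank_of_injective hinj
  · rw [Nat.one_le_iff_ne_zero]
    intro h
    exact hev (Submodule.finrank_eq_zero.1 h)

/-- The eigenspace condition is automatic for a companion matrix, so only the multiplicity has to be
tracked. -/
theorem isExceptionalPoint_iff (n : ℕ) (hn : 1 ≤ n) (t : ℕ → ℝ) (ω : ℝ) (μ : ℂ) (p : ℕ) :
    IsExceptionalPoint (transferMatrixC n t ω) μ p ↔
      2 ≤ p ∧ (transferMatrixC n t ω).charpoly.rootMultiplicity μ = p := by
  refine ⟨fun h => ⟨h.1, h.2.1⟩, fun h => ⟨h.1, h.2, ?_⟩⟩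
  refine finrank_eigenspace_transferMatrixC n hn t ω μ ?_
  refine ((Polynomial.rootMultiplicity_pos (Matrix.charpoly_monic _).ne_zero).1 ?_)
  omega

/-! ### Inversion of a monotone branch with a zero of finite order. -/

theorem exists_pos_deriv_of_tendsto {g : ℝ → ℝ} {p : ℕ} {A : ℝ} (hA : 0 < A)
    (hg : Tendsto (fun x => g x / x ^ p) (𝓝[>] 0) (𝓝 A)) :
    ∃ η > 0, ∀ x ∈ Set.Ioc 0 η, 0 < g x := by
  have h := hg.eventually (lt_mem_nhds hA)
  rw [eventually_nhdsWithin_iff, Metric.eventually_nhds_iff] at h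
  obtain ⟨e, he, h⟩ := h
  refine ⟨e / 2, by positivity, fun x hx => ?_⟩
  have h1 := h (y := x) (by rw [Real.dist_eq, sub_zero, abs_of_pos hx.1]; linarith [hx.2]) hx.1
  exact (div_pos_iff_of_pos_right (pow_pos hx.1 p)).1 h1

/-- The inverse function of a strictly increasing branch that vanishes to order `p` at `0`. -/
theorem exists_branch_inverse {G g : ℝ → ℝ} (hG : ∀ x, HasDerivAt G (g x) x) (hG0 : G 0 = 0)
    {p : ℕ} (hp : 1 ≤ p) {A : ℝ} (hA : 0 < A)
    (hGA : Tendsto (fun x => G x / x ^ p) (𝓝[>] 0) (𝓝 A))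
    (hgA : Tendsto (fun x => g x / x ^ (p - 1)) (𝓝[>] 0) (𝓝 (p * A)))
    {η : ℝ} (hη : 0 < η) (hpos : ∀ x ∈ Set.Ioc 0 η, 0 < g x) :
    ∃ (h : ℝ → ℝ) (c : ℝ), 0 < c ∧ (∀ x ∈ Set.Ioo 0 η, 0 < G x) ∧
      (∀ δ ∈ Set.Ioo 0 c, h δ ∈ Set.Ioo 0 η ∧ G (h δ) = δ ∧
        (∀ x ∈ Set.Ioo 0 η, G x < δ ↔ x < h δ) ∧ (∀ x ∈ Set.Ioo 0 η, G x = δ ↔ x = h δ) ∧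
        DifferentiableAt ℝ h δ) ∧
      ∃ C : ℝ, 0 < C ∧ Tendsto (fun δ => deriv h δ / δ ^ (-((p : ℝ) - 1) / (p : ℝ)))
        (𝓝[>] 0) (𝓝 C) := by
  have hcont : Continuous G := continuous_iff_continuousAt.2 fun x => (hG x).continuousAt
  have hmono : StrictMonoOn G (Set.Icc 0 η) := by
    refine strictMonoOn_of_deriv_pos (convex_Icc 0 η) hcont.continuousOn fun x hx => ?_
    rw [interior_Icc] at hx
    rw [(hG x).deriv]
    exact hpos x ⟨hx.1, hx.2.le⟩
  have hsub : Set.Ioo 0 η ⊆ Set.Icc 0 η := Set.Ioo_subset_Icc_self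
  have hGpos : ∀ x ∈ Set.Ioo 0 η, 0 < G x := fun x hx => by
    rw [← hG0]; exact hmono ⟨le_rfl, hη.le⟩ (hsub hx) hx.1
  have hc : 0 < G η := by
    rw [← hG0]; exact hmono ⟨le_rfl, hη.le⟩ ⟨hη.le, le_rfl⟩ hη
  have hex : ∀ δ ∈ Set.Ioo 0 (G η), ∃ x ∈ Set.Ioo 0 η, G x = δ := fun δ hδ => by
    rw [← hG0] at hδ
    exact intermediate_value_Ioo hη.le hcont.continuousOn hδ
  choose! h hmem hGh using hex
  have hlt : ∀ δ ∈ Set.Ioo 0 (G η), ∀ x ∈ Set.Ioo 0 η, G x < δ ↔ x < h δ := fun δ hδ x hx => by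
    conv_lhs => rw [← hGh δ hδ]
    exact hmono.lt_iff_lt (hsub hx) (hsub (hmem δ hδ))
  have heq : ∀ δ ∈ Set.Ioo 0 (G η), ∀ x ∈ Set.Ioo 0 η, G x = δ ↔ x = h δ := fun δ hδ x hx => by
    conv_lhs => rw [← hGh δ hδ]
    exact hmono.injOn.eq_iff (hsub hx) (hsub (hmem δ hδ))
  have hmaps : ∀ x ∈ Set.Ioo 0 η, G x ∈ Set.Ioo 0 (G η) := fun x hx =>
    ⟨hGpos x hx, hmono (hsub hx) ⟨hη.le, le_rfl⟩ hx.2⟩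
  have hhG : ∀ x ∈ Set.Ioo 0 η, h (G x) = x := fun x hx =>
    ((heq (G x) (hmaps x hx) x hx).1 rfl).symm
  have hhmono : StrictMonoOn h (Set.Ioo 0 (G η)) := fun δ hδ δ' hδ' hlt' => by
    rw [← hlt δ' hδ' (h δ) (hmem δ hδ), hGh δ hδ]
    exact hlt'
  have himg : h '' Set.Ioo 0 (G η) = Set.Ioo 0 η := by
    apply Set.Subset.antisymm
    · rintro _ ⟨δ, hδ, rfl⟩; exact hmem δ hδ
    · intro x hx; exact ⟨G x, hmaps x hx, hhG x hx⟩
  -- A strictly monotone function whose image is an open interval is continuous.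
  have hhcont : ∀ δ ∈ Set.Ioo 0 (G η), ContinuousAt h δ := fun δ hδ => by
    refine hhmono.continuousAt_of_image_mem_nhds (isOpen_Ioo.mem_nhds hδ) ?_
    rw [himg]
    exact isOpen_Ioo.mem_nhds (hmem δ hδ)
  have hderiv : ∀ δ ∈ Set.Ioo 0 (G η), HasDerivAt h (g (h δ))⁻¹ δ := fun δ hδ => by
    refine HasDerivAt.of_local_left_inverse (hhcont δ hδ) (hG (h δ))
      (hpos _ ⟨(hmem δ hδ).1, (hmem δ hδ).2.le⟩).ne' ?_
    filter_upwards [isOpen_Ioo.mem_nhds hδ] with y hy using hGh y hy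
  have hsmall : ∀ᶠ δ in 𝓝[>] (0 : ℝ), δ ∈ Set.Ioo 0 (G η) := Ioo_mem_nhdsGT hc
  have hlim : Tendsto h (𝓝[>] 0) (𝓝[>] 0) := by
    rw [tendsto_nhdsWithin_iff]
    refine ⟨?_, hsmall.mono fun δ hδ => (hmem δ hδ).1⟩
    rw [tendsto_order]
    constructor
    · intro a ha
      exact hsmall.mono fun δ hδ => ha.trans (hmem δ hδ).1
    · intro a ha
      have hx : min a η / 2 ∈ Set.Ioo 0 η := by
        have h1 : 0 < min a η := lt_min ha hη
        constructor
        · linarith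
        · linarith [min_le_right a η]
      filter_upwards [hsmall, Ioo_mem_nhdsGT (hGpos _ hx)] with δ hδ hδ'
      have h1 : h δ < min a η / 2 := by
        have := (hhmono hδ (hmaps _ hx) hδ'.2)
        rwa [hhG _ hx] at this
      have h2 : 0 < min a η := lt_min ha hη
      linarith [min_le_left a η]
  -- The constant: with `x = h δ` one has `h' = 1 / g x` and `δ^((p-1)/p) = (G x / x^p)^((p-1)/p) *
  -- x^(p-1)`, so the quotient tends to `A^((p-1)/p) / (p A)`.
  refine ⟨h, G η, hc, hGpos, fun δ hδ => ⟨hmem δ hδ, hGh δ hδ, hlt δ hδ, heq δ hδ,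
    (hderiv δ hδ).differentiableAt⟩, A ^ (((p : ℝ) - 1) / p) * (p * A)⁻¹, ?_, ?_⟩
  · have : (0 : ℝ) < p := by exact_mod_cast hp
    positivity
  · have hp0 : (0 : ℝ) < p := by exact_mod_cast hp
    have hT : Tendsto (fun x => (G x / x ^ p) ^ (((p : ℝ) - 1) / p) * (g x / x ^ (p - 1))⁻¹)
        (𝓝[>] 0) (𝓝 (A ^ (((p : ℝ) - 1) / p) * (p * A)⁻¹)) :=
      (hGA.rpow_const (Or.inl hA.ne')).mul (hgA.inv₀ (by positivity))
    refine (hT.comp hlim).congr' ?_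
    filter_upwards [hsmall] with δ hδ
    have hx := (hmem δ hδ).1
    rw [Function.comp_apply, hGh δ hδ, (hderiv δ hδ).deriv]
    set x := h δ
    have e1 : (x ^ p) ^ (((p : ℝ) - 1) / p) = x ^ (p - 1) := by
      rw [← Real.rpow_natCast x p, ← Real.rpow_mul hx.le, mul_div_cancel₀ _ hp0.ne',
        ← Real.rpow_natCast x (p - 1), Nat.cast_sub hp, Nat.cast_one]
    rw [Real.div_rpow hδ.1.le (pow_pos hx p).le, e1, neg_div, Real.rpow_neg hδ.1.le]
    have hne : x ^ (p - 1) ≠ 0 := (pow_pos hx _).ne'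
    field_simp

/-! ### Leading coefficients of the dispersion relation at a level. -/

theorem differentiable_dispersion (n : ℕ) (t : ℕ → ℝ) : Differentiable ℝ (dispersion n t) := by
  unfold dispersion
  fun_prop

theorem continuous_deriv_dispersion (n : ℕ) (t : ℕ → ℝ) : Continuous (deriv (dispersion n t)) := by
  have : ContDiff ℝ 1 (dispersion n t) := by
    unfold dispersion
    fun_prop
  exact this.continuous_deriv le_rfl

/-- The order of vanishing of `ε - ω` at `z` is the multiplicity of the eigenvalue `e^{-iz}`. -/
theorem exists_leading_coeff (n : ℕ) (hn : 1 ≤ n) (t : ℕ → ℝ) (ht : t n ≠ 0) (ω z : ℝ) (m : ℕ)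
    (hm : (transferMatrixC n t ω).charpoly.rootMultiplicity
      (Complex.exp (-(Complex.I * (z : ℂ)))) = m) :
    ∃ B : ℝ, B ≠ 0 ∧
      Tendsto (fun x => (dispersion n t (z + x) - ω) / x ^ m) (𝓝[≠] 0) (𝓝 B) ∧
      (1 ≤ m → Tendsto (fun x => deriv (dispersion n t) (z + x) / x ^ (m - 1)) (𝓝[≠] 0)
        (𝓝 (m * B))) := by
  set P := (transferMatrixC n t ω).charpoly with hP
  set μ := Complex.exp (-(Complex.I * (z : ℂ))) with hμ
  have htC : (t n : ℂ) ≠ 0 := by exact_mod_cast ht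
  obtain ⟨Q, hPQ, hQ⟩ := Polynomial.exists_eq_pow_rootMultiplicity_mul_and_not_dvd P
    (Matrix.charpoly_monic _).ne_zero μ
  rw [hm] at hPQ
  rw [Polynomial.dvd_iff_isRoot, Polynomial.IsRoot] at hQ
  -- Splitting `(X - μ)^m` off the characteristic polynomial gives `ε(z + x) - ω = E x * w x ^ m`
  -- with `E 0 ≠ 0` and `w x / x → -iμ`. The leading coefficient is therefore `E 0 * (-iμ)^m`.
  let e : ℝ → ℂ := fun x => Complex.exp (-(Complex.I * ((z + x : ℝ) : ℂ)))
  let E : ℝ → ℂ := fun x => -(t n) * (e x ^ n)⁻¹ * Q.eval (e x)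
  let w : ℝ → ℂ := fun x => e x - μ
  have he0 : ∀ x, e x ≠ 0 := fun x => Complex.exp_ne_zero _
  have hez : e 0 = μ := by simp [e, hμ]
  have he : ∀ x, HasDerivAt e (-Complex.I * e x) x := fun x => by
    have h1 : HasDerivAt (fun x : ℝ => ((z + x : ℝ) : ℂ)) 1 x := by
      simpa using ((hasDerivAt_id x).const_add z).ofReal_comp
    have h2 := ((h1.const_mul Complex.I).neg).cexp
    simp only [mul_one] at h2
    exact h2.congr_deriv (mul_comm _ _)
  let E' : ℝ → ℂ := deriv E
  have hEd : ContDiff ℝ 1 E := by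
    have hec : ContDiff ℝ 1 e := by
      have : ContDiff ℝ 1 (fun x : ℝ => -(Complex.I * ((z + x : ℝ) : ℂ))) :=
        (contDiff_const.mul (Complex.ofRealCLM.contDiff.comp
          (contDiff_const.add contDiff_id))).neg
      exact this.cexp
    have hQc : ContDiff ℝ 1 (fun x => Q.eval (e x)) := by
      have h3 : ContDiff ℂ 1 (fun y : ℂ => Q.eval y) := by simpa using Q.contDiff_aeval (𝕜 := ℂ) 1
      exact (h3.restrict_scalars ℝ).comp hec
    exact (contDiff_const.mul ((hec.pow n).inv fun x => pow_ne_zero _ (he0 x))).mul hQc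
  have hE : ∀ x, HasDerivAt E (E' x) x := fun x =>
    (hEd.differentiable one_ne_zero x).hasDerivAt
  have hE'c : Continuous E' := hEd.continuous_deriv le_rfl
  have hF : ∀ x, ((dispersion n t (z + x) - ω : ℝ) : ℂ) = E x * w x ^ m := fun x => by
    have h1 := eval_charpoly_exp n hn t ht ω (z + x)
    rw [← hP, hPQ] at h1
    simp only [Polynomial.eval_mul, Polynomial.eval_pow, Polynomial.eval_sub, Polynomial.eval_X,
      Polynomial.eval_C] at h1
    change (t n : ℂ) * (w x ^ m * Q.eval (e x)) = e x ^ n * _ at h1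
    have h2 : e x ^ n ≠ 0 := pow_ne_zero _ (he0 x)
    rw [← neg_sub, Complex.ofReal_neg, eq_comm]
    simp only [E]
    field_simp
    linear_combination -h1
  have hw : ∀ x, HasDerivAt w (-Complex.I * e x) x := fun x => (he x).sub_const μ
  have hw0 : w 0 = 0 := by simp [w, hez]
  have hslope : Tendsto (fun x : ℝ => w x / x) (𝓝[≠] 0) (𝓝 (-Complex.I * μ)) := by
    have := hasDerivAt_iff_tendsto_slope_zero.1 (hw 0)
    rw [hez] at this
    refine this.congr fun x => ?_
    rw [zero_add, hw0, sub_zero, Complex.real_smul, Complex.ofReal_inv, div_eq_inv_mul]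
  set u := -Complex.I * μ with hu
  have hu0 : u ≠ 0 := mul_ne_zero (neg_ne_zero.2 Complex.I_ne_zero) (Complex.exp_ne_zero _)
  have hE0 : E 0 ≠ 0 := by
    simp only [E, hez]
    exact mul_ne_zero (mul_ne_zero (neg_ne_zero.2 htC)
      (inv_ne_zero (pow_ne_zero _ (Complex.exp_ne_zero _)))) hQ
  have toPunct : ∀ {f : ℝ → ℂ}, Continuous f → Tendsto f (𝓝[≠] 0) (𝓝 (f 0)) := fun hf =>
    (hf.tendsto 0).mono_left nhdsWithin_le_nhds
  have hlimC : Tendsto (fun x : ℝ => (((dispersion n t (z + x) - ω) / x ^ m : ℝ) : ℂ))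
      (𝓝[≠] 0) (𝓝 (E 0 * u ^ m)) := by
    refine ((toPunct hEd.continuous).mul (hslope.pow m)).congr fun x => ?_
    rw [Complex.ofReal_div, hF, div_pow, Complex.ofReal_pow]
    ring
  have hre := (Complex.continuous_re.tendsto _).comp hlimC
  have him := (Complex.continuous_im.tendsto _).comp hlimC
  -- As a limit of real numbers the leading coefficient is real.
  have him0 : (E 0 * u ^ m).im = 0 := by
    refine tendsto_nhds_unique him ?_
    refine tendsto_const_nhds.congr fun x => ?_
    simp only [Function.comp_apply, Complex.ofReal_im]
  have hB : (((E 0 * u ^ m).re : ℝ) : ℂ) = E 0 * u ^ m := by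
    apply Complex.ext <;> simp [him0]
  refine ⟨(E 0 * u ^ m).re, ?_, ?_, ?_⟩
  · intro h
    rw [h, Complex.ofReal_zero] at hB
    exact mul_ne_zero hE0 (pow_ne_zero _ hu0) hB.symm
  · refine hre.congr fun x => ?_
    simp only [Function.comp_apply, Complex.ofReal_re]
  · intro hm1
    -- Product rule for `E * w ^ m`; the term with `E'` keeps an extra factor `w` and drops out at
    -- `x = 0`.
    have hd : ∀ x, ((deriv (dispersion n t) (z + x) : ℝ) : ℂ)
        = w x ^ (m - 1) * (E' x * w x + m * E x * (-Complex.I * e x)) := fun x => by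
      have h1 : HasDerivAt (fun x => ((dispersion n t (z + x) - ω : ℝ) : ℂ))
          ((deriv (dispersion n t) (z + x) : ℝ) : ℂ) x :=
        (((differentiable_dispersion n t (z + x)).hasDerivAt.comp_const_add z x).sub_const
          ω).ofReal_comp
      have h2 := (hE x).mul ((hw x).fun_pow m)
      have h3 := h1.unique (h2.congr_of_eventuallyEq (Eventually.of_forall hF))
      rw [h3]
      obtain ⟨k, rfl⟩ : ∃ k, m = k + 1 := ⟨m - 1, by omega⟩
      simp only [Nat.add_sub_cancel]
      push_cast
      ring
    have hlim' : Tendsto (fun x : ℝ => ((deriv (dispersion n t) (z + x) / x ^ (m - 1) : ℝ) : ℂ))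
        (𝓝[≠] 0) (𝓝 (u ^ (m - 1) * (E' 0 * w 0 + m * E 0 * (-Complex.I * e 0)))) := by
      have hcont : Continuous fun x => E' x * w x + m * E x * (-Complex.I * e x) := by
        have hec : Continuous e := continuous_iff_continuousAt.2 fun x => (he x).continuousAt
        have hEc := hEd.continuous
        fun_prop
      refine ((hslope.pow (m - 1)).mul (toPunct hcont)).congr fun x => ?_
      rw [Complex.ofReal_div, hd, div_pow, Complex.ofReal_pow]
      ring
    have hval : u ^ (m - 1) * (E' 0 * w 0 + m * E 0 * (-Complex.I * e 0))
        = ((m * (E 0 * u ^ m).re : ℝ) : ℂ) := by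
      rw [Complex.ofReal_mul, hB, hw0, hez, ← hu]
      obtain ⟨k, rfl⟩ : ∃ k, m = k + 1 := ⟨m - 1, by omega⟩
      simp only [Nat.add_sub_cancel]
      push_cast
      ring
    rw [hval] at hlim'
    have := (Complex.continuous_re.tendsto _).comp hlim'
    refine this.congr fun x => ?_
    simp only [Function.comp_apply, Complex.ofReal_re]

/-! ### Branches at the zeros: level sets and measures of sublevel sets. -/

/-- The half-neighbourhood of length `η` to the right (`b.2 = 1`) or left (`b.2 = -1`) of `b.1`. -/
def halfNhd (η : ℝ) (b : ℝ × ℝ) : Set ℝ := {k | b.2 * (k - b.1) ∈ Set.Ioo 0 η}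

/-- The sign near `b.1`, on the side `b.2`, of a function with leading term
`B b.1 * (k - b.1) ^ m b.1`. -/
noncomputable def branchSign (m : ℝ → ℕ) (B : ℝ → ℝ) (b : ℝ × ℝ) : ℝ :=
  if 0 < B b.1 * b.2 ^ m b.1 then 1 else -1

/-- The branches at the points of `Z` on which the sign is `s`. -/
noncomputable def branches (Z : Finset ℝ) (m : ℝ → ℕ) (B : ℝ → ℝ) (s : ℝ) : Finset (ℝ × ℝ) :=
  (Z ×ˢ {1, -1}).filter fun b => branchSign m B b = s

theorem branchSign_eq_or (m : ℝ → ℕ) (B : ℝ → ℝ) (b : ℝ × ℝ) :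
    branchSign m B b = 1 ∨ branchSign m B b = -1 := by
  unfold branchSign
  split_ifs <;> simp

theorem branchSign_mul_pos {m : ℝ → ℕ} {B : ℝ → ℝ} {b : ℝ × ℝ} (hB : B b.1 ≠ 0)
    (hb : b.2 = 1 ∨ b.2 = -1) : 0 < branchSign m B b * (B b.1 * b.2 ^ m b.1) := by
  have hne : B b.1 * b.2 ^ m b.1 ≠ 0 := by
    refine mul_ne_zero hB (pow_ne_zero _ ?_)
    rcases hb with h | h <;> rw [h] <;> norm_num
  unfold branchSign
  split_ifs with h
  · simpa using h
  · have := lt_of_le_of_ne (not_lt.1 h) hne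
    linarith

theorem volume_real_preimage_reflect {τ : ℝ} (hτ : τ = 1 ∨ τ = -1) (z : ℝ) {I : Set ℝ}
    (hI : MeasurableSet I) :
    MeasureTheory.volume.real {k : ℝ | τ * (k - z) ∈ I} = MeasureTheory.volume.real I := by
  rcases hτ with rfl | rfl
  · have := (MeasureTheory.measurePreserving_sub_right MeasureTheory.volume z).measure_preimage
      hI.nullMeasurableSet
    simp only [one_mul, MeasureTheory.measureReal_def]
    exact congrArg ENNReal.toReal this
  · have := (MeasureTheory.Measure.measurePreserving_sub_left MeasureTheory.volume z).measure_preimage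
      hI.nullMeasurableSet
    simp only [neg_mul, one_mul, neg_sub, MeasureTheory.measureReal_def]
    exact congrArg ENNReal.toReal this

theorem halfNhd_subset {η : ℝ} {b : ℝ × ℝ} (hb : b.2 = 1 ∨ b.2 = -1) :
    halfNhd η b ⊆ {k | k ≠ b.1 ∧ |k - b.1| < η} := by
  intro k hk
  simp only [halfNhd, Set.mem_ofPred_eq, Set.mem_Ioo] at hk
  have hne : k ≠ b.1 := fun h => by
    rw [h] at hk
    simp at hk
  refine ⟨hne, ?_⟩
  rw [abs_lt]
  rcases hb with h | h <;> rw [h] at hk <;> constructor <;> linarith [hk.1, hk.2]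

theorem measurableSet_halfNhd (η : ℝ) (b : ℝ × ℝ) : MeasurableSet (halfNhd η b) := by
  unfold halfNhd
  exact measurableSet_Ioo.preimage (by fun_prop)

theorem pairwiseDisjoint_halfNhd {Z : Finset ℝ} {η : ℝ}
    (hsep : ∀ z ∈ Z, ∀ z' ∈ Z, z ≠ z' → 2 * η < |z - z'|) :
    Set.PairwiseDisjoint ((Z ×ˢ {1, -1} : Finset (ℝ × ℝ)) : Set (ℝ × ℝ)) (halfNhd η) := by
  rintro ⟨z, τ⟩ hb ⟨z', τ'⟩ hb' hne
  simp only [Finset.coe_product, Set.mem_prod, Finset.mem_coe, Finset.mem_insert,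
    Finset.mem_singleton] at hb hb'
  refine Set.disjoint_left.2 fun k hk hk' => ?_
  by_cases hz : z = z'
  · subst hz
    simp only [halfNhd, Set.mem_ofPred_eq, Set.mem_Ioo] at hk hk'
    rcases hb.2 with rfl | rfl <;> rcases hb'.2 with rfl | rfl
    · exact hne rfl
    · linarith [hk.1, hk'.1]
    · linarith [hk.1, hk'.1]
    · exact hne rfl
  · have h1 := (halfNhd_subset hb.2 hk).2
    have h2 := (halfNhd_subset hb'.2 hk').2
    have h3 := hsep z hb.1 z' hb'.1 hz
    have h4 : |z - z'| ≤ |k - z| + |k - z'| := by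
      rw [abs_sub_comm k z]
      exact abs_sub_le z k z'
    simp only at h1 h2
    linarith

/-- Near the level `0`, the sublevel sets and level sets of `f` are described by the inverse
functions of its branches at the zeros. -/
theorem exists_branches {f f' : ℝ → ℝ} (hf : ∀ x, HasDerivAt f (f' x) x) {a b : ℝ}
    {Z : Finset ℝ} (hZ : ∀ x, x ∈ Z ↔ x ∈ Set.Icc a b ∧ f x = 0) (ha : f a ≠ 0) (hb : f b ≠ 0)
    {m : ℝ → ℕ} {B : ℝ → ℝ} (hm : ∀ z ∈ Z, 1 ≤ m z) (hB : ∀ z ∈ Z, B z ≠ 0)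
    (hlim : ∀ z ∈ Z, Tendsto (fun x => f (z + x) / x ^ m z) (𝓝[≠] 0) (𝓝 (B z)))
    (hlim' : ∀ z ∈ Z, Tendsto (fun x => f' (z + x) / x ^ (m z - 1)) (𝓝[≠] 0)
      (𝓝 (m z * B z))) :
    ∃ (h : ℝ × ℝ → ℝ → ℝ) (c : ℝ), 0 < c ∧
      (∀ b ∈ Z ×ˢ {1, -1}, (∀ δ ∈ Set.Ioo 0 c, DifferentiableAt ℝ (h b) δ) ∧
        ∃ C : ℝ, 0 < C ∧ Tendsto
          (fun δ => deriv (h b) δ / δ ^ (-((m b.1 : ℝ) - 1) / (m b.1 : ℝ))) (𝓝[>] 0) (𝓝 C)) ∧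
      ∀ s : ℝ, s = 1 ∨ s = -1 →
        (∃ K : ℝ, ∀ δ ∈ Set.Ioo 0 c, MeasureTheory.volume.real {k | k ∈ Set.Icc a b ∧ f k ≤ s * δ}
          = K + s * ∑ b ∈ branches Z m B s, h b δ) ∧
        ∀ δ ∈ Set.Ioo 0 c,
          {k | k ∈ Set.Icc a b ∧ f k = s * δ}.ncard = (branches Z m B s).card ∧
          ∀ k ∈ Set.Icc a b, f k = s * δ → f' k ≠ 0 := by
  have hcont : Continuous f := continuous_iff_continuousAt.2 fun x => (hf x).continuousAt
  set W : Finset (ℝ × ℝ) := Z ×ˢ {1, -1} with hW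
  have hW1 : ∀ b ∈ W, b.1 ∈ Z := fun b hb => (Finset.mem_product.1 hb).1
  have hW2 : ∀ b ∈ W, b.2 = 1 ∨ b.2 = -1 := fun b hb => by
    simpa using (Finset.mem_product.1 hb).2
  set σ := branchSign m B with hσ
  have hσ1 : ∀ b, σ b = 1 ∨ σ b = -1 := branchSign_eq_or m B
  have hσσ : ∀ b, σ b * σ b = 1 := fun b => by rcases hσ1 b with h | h <;> rw [h] <;> norm_num
  -- The direction `b.2` and the sign `σ b` normalise each branch to start at `0` and increase, with
  -- leading coefficient `A b > 0`.
  let G : ℝ × ℝ → ℝ → ℝ := fun b x => σ b * f (b.1 + b.2 * x)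
  let g : ℝ × ℝ → ℝ → ℝ := fun b x => σ b * (f' (b.1 + b.2 * x) * b.2)
  have hG : ∀ b x, HasDerivAt (G b) (g b x) x := fun b x => by
    have h1 : HasDerivAt (fun x => b.1 + b.2 * x) b.2 x := by
      simpa using ((hasDerivAt_id x).const_mul b.2).const_add b.1
    exact ((hf _).comp x h1).const_mul (σ b)
  have hG0 : ∀ b ∈ W, G b 0 = 0 := fun b hb => by
    simp [G, ((hZ b.1).1 (hW1 b hb)).2]
  let A : ℝ × ℝ → ℝ := fun b => σ b * (B b.1 * b.2 ^ m b.1)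
  have hA : ∀ b ∈ W, 0 < A b := fun b hb => branchSign_mul_pos (hB _ (hW1 b hb)) (hW2 b hb)
  have hdir : ∀ b ∈ W, Tendsto (fun x : ℝ => b.2 * x) (𝓝[>] 0) (𝓝[≠] 0) := fun b hb => by
    rw [tendsto_nhdsWithin_iff]
    constructor
    · have : Tendsto (fun x : ℝ => b.2 * x) (𝓝 0) (𝓝 (b.2 * 0)) :=
        (continuous_const.mul continuous_id).tendsto 0
      rw [mul_zero] at this
      exact this.mono_left nhdsWithin_le_nhds
    · filter_upwards [self_mem_nhdsWithin] with x hx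
      refine mul_ne_zero ?_ (ne_of_gt hx)
      rcases hW2 b hb with h | h <;> rw [h] <;> norm_num
  have hGA : ∀ b ∈ W, Tendsto (fun x => G b x / x ^ m b.1) (𝓝[>] 0) (𝓝 (A b)) := fun b hb => by
    have := (((hlim _ (hW1 b hb)).comp (hdir b hb)).mul_const (b.2 ^ m b.1)).const_mul (σ b)
    refine this.congr fun x => ?_
    have h2 : b.2 ^ m b.1 ≠ 0 := by
      apply pow_ne_zero
      rcases hW2 b hb with h | h <;> rw [h] <;> norm_num
    simp only [Function.comp_apply, G, mul_pow]
    field_simp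
  have hgA : ∀ b ∈ W, Tendsto (fun x => g b x / x ^ (m b.1 - 1)) (𝓝[>] 0)
      (𝓝 (m b.1 * A b)) := fun b hb => by
    have := (((hlim' _ (hW1 b hb)).comp (hdir b hb)).mul_const (b.2 ^ m b.1)).const_mul (σ b)
    have e : σ b * (m b.1 * B b.1 * b.2 ^ m b.1) = m b.1 * A b := by simp only [A]; ring
    rw [e] at this
    refine this.congr fun x => ?_
    have h0 : b.2 ≠ 0 := by rcases hW2 b hb with h | h <;> rw [h] <;> norm_num
    have h2 : b.2 ^ (m b.1 - 1) ≠ 0 := pow_ne_zero _ h0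
    have h3 : b.2 ^ m b.1 = b.2 ^ (m b.1 - 1) * b.2 := by
      rw [← pow_succ, Nat.sub_add_cancel (hm _ (hW1 b hb))]
    simp only [Function.comp_apply, g, mul_pow, h3]
    field_simp
  -- No zero lies at an endpoint, so both half-neighbourhoods of every zero fit into `[a, b]`.
  have hZint : ∀ z ∈ Z, a < z ∧ z < b := fun z hz => by
    obtain ⟨⟨h1, h2⟩, h3⟩ := (hZ z).1 hz
    exact ⟨lt_of_le_of_ne h1 fun h => ha (h ▸ h3), lt_of_le_of_ne h2 fun h => hb (h ▸ h3)⟩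
  -- a common length of the branches
  obtain ⟨η, hη, hgpos, hηab, hsep⟩ : ∃ η > 0, (∀ b ∈ W, ∀ x ∈ Set.Ioc 0 η, 0 < g b x) ∧
      (∀ z ∈ Z, η < z - a ∧ η < b - z) ∧ ∀ z ∈ Z, ∀ z' ∈ Z, z ≠ z' → 2 * η < |z - z'| := by
    have hev : ∀ {r : ℝ}, 0 < r → ∀ᶠ η in 𝓝[>] (0 : ℝ), η < r := fun hr =>
      eventually_of_mem (Ioo_mem_nhdsGT hr) fun x hx => hx.2
    have e1 : ∀ᶠ η in 𝓝[>] (0 : ℝ), ∀ b ∈ W, ∀ x ∈ Set.Ioc 0 η, 0 < g b x := by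
      rw [Filter.eventually_all_finset]
      intro b hb
      have hm1 : (0 : ℝ) < m b.1 := by exact_mod_cast hm _ (hW1 b hb)
      obtain ⟨η, hη, h⟩ := exists_pos_deriv_of_tendsto (mul_pos hm1 (hA b hb)) (hgA b hb)
      filter_upwards [hev hη] with η' hη' x hx
      exact h x ⟨hx.1, hx.2.trans hη'.le⟩
    have e2 : ∀ᶠ η in 𝓝[>] (0 : ℝ), ∀ z ∈ Z, η < z - a ∧ η < b - z := by
      rw [Filter.eventually_all_finset]
      intro z hz
      exact (hev (sub_pos.2 (hZint z hz).1)).and (hev (sub_pos.2 (hZint z hz).2))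
    have e3 : ∀ᶠ η in 𝓝[>] (0 : ℝ), ∀ z ∈ Z, ∀ z' ∈ Z, z ≠ z' → 2 * η < |z - z'| := by
      rw [Filter.eventually_all_finset]
      intro z hz
      rw [Filter.eventually_all_finset]
      intro z' hz'
      by_cases h : z = z'
      · exact Eventually.of_forall fun _ h' => absurd h h'
      · have : 0 < |z - z'| / 2 := by
          have := abs_pos.2 (sub_ne_zero.2 h)
          positivity
        filter_upwards [hev this] with η hη _
        linarith
    obtain ⟨η, h0, h1, h2, h3⟩ :=
      ((eventually_mem_nhdsWithin (a := (0 : ℝ)) (s := Set.Ioi 0)).and (e1.and (e2.and e3))).exists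
    exact ⟨η, h0, h1, h2, h3⟩
  have key := fun b (hb : b ∈ W) => exists_branch_inverse (hG b) (hG0 b hb) (hm _ (hW1 b hb))
    (hA b hb) (hGA b hb) (hgA b hb) hη (hgpos b hb)
  choose! h cb hcb hGpos hh hasym using key
  have hJsub : ∀ b' ∈ W, halfNhd η b' ⊆ Set.Icc a b := fun b' hb' k hk => by
    have h1 := abs_lt.1 (halfNhd_subset (hW2 b' hb') hk).2
    have h2 := hηab _ (hW1 b' hb')
    constructor <;> linarith
  have hdisj : Set.PairwiseDisjoint (W : Set (ℝ × ℝ)) (halfNhd η) := pairwiseDisjoint_halfNhd hsep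
  set U : Set ℝ := ⋃ b ∈ W, halfNhd η b with hU
  -- away from the branches the function vanishes or is bounded below
  obtain ⟨c₀, hc₀, hfar⟩ : ∃ c₀ > 0, ∀ k ∈ Set.Icc a b, k ∉ U → f k = 0 ∨ c₀ ≤ |f k| := by
    -- Points outside `U` where `f ≠ 0` lie in this compact set, on which `|f|` has a positive
    -- minimum. The zeros are not in `U` either, hence the alternative `f k = 0`.
    have hK : IsCompact (Set.Icc a b \ ⋃ z ∈ Z, Set.Ioo (z - η) (z + η)) :=
      isCompact_Icc.diff (isOpen_biUnion fun _ _ => isOpen_Ioo)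
    have hnear : ∀ k ∈ Set.Icc a b, k ∉ U → f k ≠ 0 →
        k ∈ Set.Icc a b \ ⋃ z ∈ Z, Set.Ioo (z - η) (z + η) := fun k hk hkU hk0 => by
      refine ⟨hk, fun hmem => hkU ?_⟩
      simp only [Set.mem_iUnion, exists_prop] at hmem
      obtain ⟨z, hz, hkz⟩ := hmem
      have hne : k ≠ z := fun h => hk0 (h ▸ ((hZ z).1 hz).2)
      simp only [hU, Set.mem_iUnion, exists_prop]
      rcases lt_or_gt_of_ne hne with hlt | hlt
      · refine ⟨(z, -1), by simp [hW, hz], ?_⟩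
        simp only [halfNhd, Set.mem_ofPred_eq, Set.mem_Ioo]
        constructor <;> linarith [hkz.1]
      · refine ⟨(z, 1), by simp [hW, hz], ?_⟩
        simp only [halfNhd, Set.mem_ofPred_eq, Set.mem_Ioo]
        constructor <;> linarith [hkz.2]
    rcases Set.eq_empty_or_nonempty (Set.Icc a b \ ⋃ z ∈ Z, Set.Ioo (z - η) (z + η)) with he | hne
    · refine ⟨1, one_pos, fun k hk hkU => Or.inl ?_⟩
      by_contra hk0
      have := hnear k hk hkU hk0
      rw [he] at this
      exact this
    · obtain ⟨k₁, hk₁, hmin⟩ := hK.exists_isMinOn hne hcont.abs.continuousOn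
      refine ⟨|f k₁|, ?_, fun k hk hkU => ?_⟩
      · refine abs_pos.2 fun h0 => hk₁.2 ?_
        simp only [Set.mem_iUnion, exists_prop]
        exact ⟨k₁, (hZ k₁).2 ⟨hk₁.1, h0⟩, by constructor <;> linarith⟩
      · by_cases hk0 : f k = 0
        · exact Or.inl hk0
        · exact Or.inr (hmin (hnear k hk hkU hk0))
  obtain ⟨c, hc, hcc₀, hccb⟩ : ∃ c > 0, c ≤ c₀ ∧ ∀ b ∈ W, c ≤ cb b := by
    have e1 : ∀ᶠ c in 𝓝[>] (0 : ℝ), ∀ b ∈ W, c ≤ cb b := by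
      rw [Filter.eventually_all_finset]
      intro b hb
      exact eventually_of_mem (Ioo_mem_nhdsGT (hcb b hb)) fun x hx => hx.2.le
    have e2 : ∀ᶠ c in 𝓝[>] (0 : ℝ), c ≤ c₀ := eventually_of_mem (Ioo_mem_nhdsGT hc₀) fun x hx => hx.2.le
    obtain ⟨c, h0, h1, h2⟩ :=
      ((eventually_mem_nhdsWithin (a := (0 : ℝ)) (s := Set.Ioi 0)).and (e2.and e1)).exists
    exact ⟨c, h0, h1, h2⟩
  have hmemcb : ∀ b ∈ W, ∀ δ ∈ Set.Ioo 0 c, δ ∈ Set.Ioo 0 (cb b) := fun b hb δ hδ =>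
    ⟨hδ.1, hδ.2.trans_le (hccb b hb)⟩
  -- on a branch, `f` is `± G`
  have hfG : ∀ b ∈ W, ∀ k, f k = σ b * G b (b.2 * (k - b.1)) := fun b hb k => by
    have h1 : b.1 + b.2 * (b.2 * (k - b.1)) = k := by
      rcases hW2 b hb with h | h <;> rw [h] <;> ring
    simp only [G, h1]
    rw [← mul_assoc, hσσ, one_mul]
  refine ⟨h, c, hc, fun b hb => ⟨fun δ hδ => (hh b hb δ (hmemcb b hb δ hδ)).2.2.2.2,
    hasym b hb⟩, fun s hs => ⟨?_, fun δ hδ => ?_⟩⟩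
  · let μ := MeasureTheory.volume.restrict (Set.Icc a b)
    have hJmeas := measurableSet_halfNhd η
    have hUmeas : MeasurableSet U := Finset.measurableSet_biUnion _ fun b _ => hJmeas b
    let F : ℝ → Set ℝ := fun δ => {k | f k ≤ s * δ}
    have hFmeas : ∀ δ, MeasurableSet (F δ) := fun δ =>
      measurableSet_le hcont.measurable measurable_const
    have hsplit : ∀ δ, MeasureTheory.volume.real {k | k ∈ Set.Icc a b ∧ f k ≤ s * δ}
        = μ.real (F δ \ U) + ∑ b ∈ W, MeasureTheory.volume.real (F δ ∩ halfNhd η b) := fun δ => by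
      have h1 : MeasureTheory.volume.real {k | k ∈ Set.Icc a b ∧ f k ≤ s * δ} = μ.real (F δ) := by
        rw [MeasureTheory.measureReal_restrict_apply (hFmeas δ), Set.inter_comm]
        rfl
      rw [h1, ← MeasureTheory.measureReal_sdiff_add_inter (s := F δ) hUmeas]
      congr 1
      rw [hU, Set.inter_iUnion₂, MeasureTheory.measureReal_biUnion_finset]
      · refine Finset.sum_congr rfl fun b' hb' => ?_
        rw [MeasureTheory.measureReal_restrict_apply ((hFmeas δ).inter (hJmeas b'))]
        congr 1
        exact Set.inter_eq_left.2 (Set.inter_subset_right.trans (hJsub b' hb'))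
      · exact hdisj.mono fun b => Set.inter_subset_right
      · exact fun b _ => (hFmeas δ).inter (hJmeas b)
    -- Off `U` either `f = 0` or `|f| ≥ c₀ ≥ c > δ`, so whether `f k ≤ s * δ` does not depend on
    -- `δ`; `c / 2` is an arbitrary reference value.
    have hconst : ∀ δ ∈ Set.Ioo 0 c, μ.real (F δ \ U) = μ.real (F (c / 2) \ U) := fun δ hδ => by
      have hc2 : c / 2 ∈ Set.Ioo 0 c := ⟨by positivity, by linarith⟩
      rw [MeasureTheory.measureReal_restrict_apply ((hFmeas _).diff hUmeas),
        MeasureTheory.measureReal_restrict_apply ((hFmeas _).diff hUmeas)]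
      congr 1
      have hle : ∀ k ∈ Set.Icc a b, k ∉ U → ∀ δ ∈ Set.Ioo 0 c, ∀ δ' ∈ Set.Ioo 0 c,
          f k ≤ s * δ → f k ≤ s * δ' := fun k hk hkU δ hδ δ' hδ' hle => by
        rcases hfar k hk hkU with h0 | h0
        · rw [h0] at hle ⊢
          rcases hs with rfl | rfl
          · linarith [hδ'.1]
          · linarith [hδ.1]
        · rcases le_abs.1 h0 with h1 | h1
          · rcases hs with rfl | rfl
            · linarith [hδ.2]
            · linarith [hδ.1]
          · rcases hs with rfl | rfl
            · linarith [hδ'.1]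
            · linarith [hδ'.2]
      ext k
      exact ⟨fun ⟨⟨h1, h2⟩, h3⟩ => ⟨⟨hle k h3 h2 _ hδ _ hc2 h1, h2⟩, h3⟩,
        fun ⟨⟨h1, h2⟩, h3⟩ => ⟨⟨hle k h3 h2 _ hc2 _ hδ h1, h2⟩, h3⟩⟩
    -- A branch of sign `s` contributes length `h b δ` if `s = 1` and `η - h b δ` if `s = -1`. A
    -- branch of sign `-s` lies entirely inside the sublevel set for `s = 1` and entirely outside
    -- for `s = -1`.
    have hpiece : ∀ b ∈ W, ∃ κ : ℝ, ∀ δ ∈ Set.Ioo 0 c,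
        MeasureTheory.volume.real (F δ ∩ halfNhd η b)
          = κ + s * (if σ b = s then h b δ else 0) := fun b hb => by
      have hvol := fun (I : Set ℝ) (hI : MeasurableSet I) =>
        volume_real_preimage_reflect (hW2 b hb) b.1 hI
      have hset : ∀ (δ : ℝ) (I : Set ℝ), (∀ x, x ∈ I ↔ x ∈ Set.Ioo 0 η ∧ σ b * G b x ≤ s * δ) →
          F δ ∩ halfNhd η b = {k | b.2 * (k - b.1) ∈ I} := fun δ I hI => by
        ext k
        rw [Set.mem_ofPred_eq, hI, ← hfG b hb k, and_comm]
        rfl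
      by_cases hsb : σ b = s
      · rcases hs with rfl | rfl
        · refine ⟨0, fun δ hδ => ?_⟩
          obtain ⟨h1, h2, h3, h4, -⟩ := hh b hb δ (hmemcb b hb δ hδ)
          rw [hset δ (Set.Ioc 0 (h b δ)), hvol _ measurableSet_Ioc, if_pos hsb,
            Real.volume_real_Ioc_of_le h1.1.le]
          · ring
          · intro x
            rw [hsb]
            constructor
            · rintro ⟨hx1, hx2⟩
              have hx : x ∈ Set.Ioo 0 η := ⟨hx1, hx2.trans_lt h1.2⟩
              refine ⟨hx, ?_⟩
              rw [one_mul, one_mul, le_iff_lt_or_eq, h3 x hx, h4 x hx]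
              exact hx2.lt_or_eq
            · rintro ⟨hx, hx2⟩
              rw [one_mul, one_mul, le_iff_lt_or_eq, h3 x hx, h4 x hx] at hx2
              exact ⟨hx.1, le_iff_lt_or_eq.2 hx2⟩
        · refine ⟨η, fun δ hδ => ?_⟩
          obtain ⟨h1, h2, h3, h4, -⟩ := hh b hb δ (hmemcb b hb δ hδ)
          rw [hset δ (Set.Ico (h b δ) η), hvol _ measurableSet_Ico, if_pos hsb,
            Real.volume_real_Ico_of_le h1.2.le]
          · ring
          · intro x
            rw [hsb]
            constructor
            · rintro ⟨hx1, hx2⟩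
              have hx : x ∈ Set.Ioo 0 η := ⟨h1.1.trans_le hx1, hx2⟩
              refine ⟨hx, ?_⟩
              have := (h3 x hx).not.2 (not_lt.2 hx1)
              linarith
            · rintro ⟨hx, hx2⟩
              refine ⟨not_lt.1 ((h3 x hx).not.1 ?_), hx.2⟩
              linarith
      · have hneg : σ b = -s := by
          rcases hσ1 b with h1 | h1 <;> rcases hs with rfl | rfl <;>
            first | exact absurd h1 hsb | linarith
        rcases hs with rfl | rfl
        · refine ⟨η, fun δ hδ => ?_⟩
          rw [hset δ (Set.Ioo 0 η), hvol _ measurableSet_Ioo, if_neg hsb,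
            Real.volume_real_Ioo_of_le hη.le]
          · ring
          · intro x
            refine ⟨fun hx => ⟨hx, ?_⟩, fun hx => hx.1⟩
            rw [hneg]
            linarith [hδ.1, hGpos b hb x hx]
        · refine ⟨0, fun δ hδ => ?_⟩
          rw [hset δ ∅, hvol _ MeasurableSet.empty, if_neg hsb]
          · simp
          · intro x
            refine ⟨fun hx => hx.elim, fun hx => ?_⟩
            rw [hneg] at hx
            linarith [hδ.1, hGpos b hb x hx.1, hx.2]
    choose! κ hκ using hpiece
    refine ⟨μ.real (F (c / 2) \ U) + ∑ b ∈ W, κ b, fun δ hδ => ?_⟩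
    rw [hsplit, hconst δ hδ, Finset.sum_congr rfl fun b hb => hκ b hb δ hδ,
      Finset.sum_add_distrib, ← Finset.mul_sum, branches, Finset.sum_filter]
    ring
  -- `φ b` is the unique crossing of the level on the branch `b`. Disjointness of the
  -- half-neighbourhoods makes `φ` injective.
  · let φ : ℝ × ℝ → ℝ := fun b => b.1 + b.2 * h b δ
    have hmemJ : ∀ b ∈ W, φ b ∈ halfNhd η b := fun b hb => by
      have h1 : b.2 * (φ b - b.1) = h b δ := by
        simp only [φ]
        rcases hW2 b hb with h | h <;> rw [h] <;> ring
      simp only [halfNhd, Set.mem_ofPred_eq, h1]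
      exact (hh b hb δ (hmemcb b hb δ hδ)).1
    have hSW : ∀ b, b ∈ branches Z m B s ↔ b ∈ W ∧ σ b = s := fun b => by
      rw [branches, Finset.mem_filter]
    have hfind : ∀ k ∈ Set.Icc a b, f k = s * δ → ∃ b ∈ branches Z m B s, φ b = k := by
      intro k hk hfk
      have hkU : k ∈ U := by
        by_contra hkU
        have hab : |f k| = δ := by
          rw [hfk, abs_mul, abs_of_pos hδ.1]
          rcases hs with rfl | rfl <;> simp
        rcases hfar k hk hkU with h0 | h0
        · rw [h0, abs_zero] at hab
          exact hδ.1.ne hab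
        · rw [hab] at h0
          linarith [hδ.2]
      simp only [hU, Set.mem_iUnion, exists_prop] at hkU
      obtain ⟨b', hb', hkb⟩ := hkU
      have hx : b'.2 * (k - b'.1) ∈ Set.Ioo 0 η := hkb
      have hpos := hGpos b' hb' _ hx
      rw [hfG b' hb' k] at hfk
      have hsb : σ b' = s := by
        rcases hσ1 b' with h1 | h1 <;> rcases hs with rfl | rfl <;> rw [h1] at hfk ⊢ <;>
          linarith [hδ.1]
      refine ⟨b', (hSW b').2 ⟨hb', hsb⟩, ?_⟩
      rw [hsb] at hfk
      have hGδ : G b' (b'.2 * (k - b'.1)) = δ := by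
        rcases hs with rfl | rfl <;> linarith
      have := ((hh b' hb' δ (hmemcb b' hb' δ hδ)).2.2.2.1 _ hx).1 hGδ
      simp only [φ]
      rw [← this]
      rcases hW2 b' hb' with h | h <;> rw [h] <;> ring
    have hval : ∀ b' ∈ branches Z m B s, φ b' ∈ Set.Icc a b ∧ f (φ b') = s * δ ∧ f' (φ b') ≠ 0 := by
      intro b' hb'
      obtain ⟨hbW, hsb⟩ := (hSW b').1 hb'
      have h1 := hh b' hbW δ (hmemcb b' hbW δ hδ)
      refine ⟨hJsub b' hbW (hmemJ b' hbW), ?_, fun h0 => ?_⟩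
      · have h2 : σ b' * f (φ b') = δ := h1.2.1
        rw [← hsb, ← h2, ← mul_assoc, hσσ, one_mul]
      · have h2 := hgpos b' hbW (h b' δ) ⟨h1.1.1, h1.1.2.le⟩
        have h3 : g b' (h b' δ) = σ b' * (f' (φ b') * b'.2) := rfl
        rw [h3, h0] at h2
        simp at h2
    refine ⟨?_, fun k hk hfk => ?_⟩
    · have himg : {k | k ∈ Set.Icc a b ∧ f k = s * δ} = φ '' (branches Z m B s : Set (ℝ × ℝ)) := by
        ext k
        constructor
        · rintro ⟨hk, hfk⟩
          exact hfind k hk hfk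
        · rintro ⟨b', hb', rfl⟩
          exact ⟨(hval b' hb').1, (hval b' hb').2.1⟩
      rw [himg, Set.InjOn.ncard_image, Set.ncard_coe_finset]
      intro b₁ hb₁ b₂ hb₂ heq
      by_contra hne
      have h1 := ((hSW b₁).1 hb₁).1
      have h2 := ((hSW b₂).1 hb₂).1
      refine Set.disjoint_left.1 (hdisj h1 h2 hne) (hmemJ b₁ h1) ?_
      rw [heq]
      exact hmemJ b₂ h2
    · obtain ⟨b', hb', rfl⟩ := hfind k hk hfk
      exact (hval b' hb').2.2

/-! ### Admissible orders of exceptional points. -/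

theorem natDegree_charpoly_transferMatrixC (n : ℕ) (t : ℕ → ℝ) (ω : ℝ) :
    (transferMatrixC n t ω).charpoly.natDegree = 2 * n := by
  rw [Matrix.charpoly_natDegree_eq_dim, Fintype.card_fin]

theorem rootMultiplicity_conj (n : ℕ) (t : ℕ → ℝ) (ω : ℝ) (μ : ℂ) :
    (transferMatrixC n t ω).charpoly.rootMultiplicity ((starRingEnd ℂ) μ)
      = (transferMatrixC n t ω).charpoly.rootMultiplicity μ := by
  have h : (transferMatrixC n t ω).charpoly.map (starRingEnd ℂ)
      = (transferMatrixC n t ω).charpoly := by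
    have h1 : (transferMatrixC n t ω).charpoly
        = (transferMatrix n t ω).charpoly.map Complex.ofRealHom :=
      Matrix.charpoly_map (transferMatrix n t ω) Complex.ofRealHom
    rw [h1, Polynomial.map_map]
    congr 1
    ext x
    simp
  conv_lhs => rw [← h]
  exact (Polynomial.eq_rootMultiplicity_map (starRingEnd ℂ).injective μ).symm

-- The coprime factors belonging to `μ` and its conjugate both divide a polynomial of degree `2n`,
-- with equal exponents because the coefficients are real.
open Polynomial in
theorem rootMultiplicity_le_of_im_ne_zero (n : ℕ) (t : ℕ → ℝ) (ω : ℝ) {μ : ℂ} (hμ : μ.im ≠ 0) :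
    (transferMatrixC n t ω).charpoly.rootMultiplicity μ ≤ n := by
  set P := (transferMatrixC n t ω).charpoly with hP
  have hne : μ ≠ (starRingEnd ℂ) μ := fun h => hμ (Complex.conj_eq_iff_im.1 h.symm)
  have hP0 : P ≠ 0 := (Matrix.charpoly_monic _).ne_zero
  have h1 := Polynomial.pow_rootMultiplicity_dvd P μ
  have h2 := Polynomial.pow_rootMultiplicity_dvd P ((starRingEnd ℂ) μ)
  rw [hP, rootMultiplicity_conj, ← hP] at h2
  have hcop : IsCoprime ((X - C μ) ^ P.rootMultiplicity μ)
      ((X - C ((starRingEnd ℂ) μ)) ^ P.rootMultiplicity μ) :=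
    (Polynomial.isCoprime_X_sub_C_of_isUnit_sub (sub_ne_zero.2 hne).isUnit).pow
  have h3 := Polynomial.natDegree_le_of_dvd (hcop.mul_dvd h1 h2) hP0
  rw [hP, natDegree_charpoly_transferMatrixC, ← hP, Polynomial.natDegree_mul
    (pow_ne_zero _ (X_sub_C_ne_zero _)) (pow_ne_zero _ (X_sub_C_ne_zero _)),
    Polynomial.natDegree_pow, Polynomial.natDegree_pow, natDegree_X_sub_C, natDegree_X_sub_C] at h3
  omega

/-- Here `z` is a multiple of `π`, so `sin (m z) = 0` and each `cos (m (z + x))` is even in `x`. -/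
theorem dispersion_reflect (n : ℕ) (t : ℕ → ℝ) {z : ℝ} (hz : Real.sin z = 0) (x : ℝ) :
    dispersion n t (z + -x) = dispersion n t (z + x) := by
  obtain ⟨j, rfl⟩ := Real.sin_eq_zero_iff.1 hz
  unfold dispersion
  congr 1
  refine Finset.sum_congr rfl fun m _ => ?_
  have h0 : Real.sin (m * (j * Real.pi)) = 0 := by
    rw [← mul_assoc]
    exact_mod_cast Real.sin_int_mul_pi (m * j)
  rw [mul_add, mul_add, Real.cos_add, Real.cos_add, h0, mul_neg, Real.cos_neg]
  ring

/-- If the order were odd, the reflection symmetry about `z` would turn the leading coefficient `B`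
into `-B`, forcing `B = 0`. -/
theorem even_rootMultiplicity_of_sin_eq_zero (n : ℕ) (hn : 1 ≤ n) (t : ℕ → ℝ) (ht : t n ≠ 0)
    (ω : ℝ) {z : ℝ} (hz : Real.sin z = 0) :
    Even ((transferMatrixC n t ω).charpoly.rootMultiplicity
      (Complex.exp (-(Complex.I * (z : ℂ))))) := by
  obtain ⟨B, hB, hlim, -⟩ := exists_leading_coeff n hn t ht ω z _ rfl
  set m := (transferMatrixC n t ω).charpoly.rootMultiplicity
      (Complex.exp (-(Complex.I * (z : ℂ))))
  by_contra hm
  rw [Nat.not_even_iff_odd] at hm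
  have hneg : Tendsto (fun x : ℝ => -x) (𝓝[≠] 0) (𝓝[≠] 0) := by
    rw [tendsto_nhdsWithin_iff]
    constructor
    · have : Tendsto (fun x : ℝ => -x) (𝓝 0) (𝓝 (-0)) := continuous_neg.tendsto 0
      rw [neg_zero] at this
      exact this.mono_left nhdsWithin_le_nhds
    · filter_upwards [self_mem_nhdsWithin] with x hx
      exact neg_ne_zero.2 hx
  have h2 : Tendsto (fun x => (dispersion n t (z + x) - ω) / x ^ m) (𝓝[≠] 0) (𝓝 (-B)) := by
    refine (hlim.comp hneg).neg.congr fun x => ?_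
    simp only [Function.comp_apply]
    rw [dispersion_reflect n t hz, hm.neg_pow, div_neg, neg_neg]
  have := tendsto_nhds_unique hlim h2
  exact hB (by linarith)

theorem exists_momentum {μ : ℂ} (hμ : ‖μ‖ = 1) :
    ∃ k : ℝ, μ = Complex.exp (-(Complex.I * (k : ℂ))) := by
  refine ⟨-μ.arg, ?_⟩
  have := Complex.norm_mul_exp_arg_mul_I μ
  rw [hμ, Complex.ofReal_one, one_mul] at this
  conv_lhs => rw [← this]
  congr 1
  push_cast
  ring

theorem exp_momentum_im (k : ℝ) : (Complex.exp (-(Complex.I * (k : ℂ)))).im = -Real.sin k := by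
  rw [show -(Complex.I * (k : ℂ)) = ((-k : ℝ) : ℂ) * Complex.I by push_cast; ring,
    Complex.exp_ofReal_mul_I_im, Real.sin_neg]

open Polynomial in
/-- Monic palindromic real polynomials of degree `2n` are characteristic polynomials of transfer
matrices. -/
theorem charpoly_eq_of_reverse_eq (n : ℕ) (hn : 1 ≤ n) (Q : ℝ[X]) (hQ : Q.Monic)
    (hdeg : Q.natDegree = 2 * n) (hrev : Q.reverse = Q) :
    (transferMatrixC n (fun m => Q.coeff (n + m)) (Q.coeff n)).charpoly
      = Q.map Complex.ofRealHom := by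
  have hlead : Q.coeff (n + n) = 1 := by
    rw [← two_mul, ← hdeg]
    exact hQ
  have h := charpoly_transferMatrixC n hn (fun m => Q.coeff (n + m)) (by rw [hlead]; simp)
    (Q.coeff n)
  rw [hlead, Complex.ofReal_one, C_1, one_mul] at h
  rw [h]
  have hsymm : ∀ m ≤ n, Q.coeff (n - m) = Q.coeff (n + m) := fun m hm => by
    conv_lhs => rw [← hrev]
    rw [Polynomial.coeff_reverse, hdeg, Polynomial.revAt_le (by omega)]
    congr 1
    omega
  ext i
  rw [Polynomial.coeff_map, Complex.ofRealHom_eq_coe, Polynomial.coeff_add,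
    Polynomial.finsetSum_coeff]
  simp only [Polynomial.coeff_C_mul, Polynomial.coeff_add, Polynomial.coeff_X_pow]
  rcases lt_trichotomy i n with hi | rfl | hi
  · rw [Finset.sum_eq_single (n - i)]
    · rw [if_neg (by omega), if_neg (by omega), if_pos (by omega), ← hsymm _ (by omega)]
      rw [show n - (n - i) = i by omega]
      simp
    · intro m hm hne
      rw [Finset.mem_Icc] at hm
      rw [if_neg (by omega), if_neg (by omega)]
      simp
    · intro hm
      rw [Finset.mem_Icc] at hm
      omega
  · rw [Finset.sum_eq_zero]
    · simp
    · intro m hm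
      rw [Finset.mem_Icc] at hm
      rw [if_neg (by omega), if_neg (by omega)]
      simp
  · by_cases hi2 : i ≤ 2 * n
    · rw [Finset.sum_eq_single (i - n)]
      · rw [if_neg (by omega), if_pos (by omega), if_neg (by omega),
          show n + (i - n) = i by omega]
        simp
      · intro m hm hne
        rw [Finset.mem_Icc] at hm
        rw [if_neg (by omega), if_neg (by omega)]
        simp
      · intro hm
        rw [Finset.mem_Icc] at hm
        omega
    · rw [Finset.sum_eq_zero, Polynomial.coeff_eq_zero_of_natDegree_lt (n := i) (by omega),
        if_neg (by omega)]
      · simp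
      · intro m hm
        rw [Finset.mem_Icc] at hm
        rw [if_neg (by omega), if_neg (by omega)]
        simp

open Polynomial in
theorem reverse_pow_eq_self {Q : ℝ[X]} (hQ : Q.reverse = Q) (i : ℕ) : (Q ^ i).reverse = Q ^ i := by
  induction i with
  | zero => rw [pow_zero, ← C_1, reverse_C]
  | succ i ih => rw [pow_succ, reverse_mul_of_domain, ih, hQ]

open Polynomial in
/-- An exceptional point at a root of the palindromic polynomial
`(X² + aX + 1)^i (X² + 2X + 1)^(n - i)`. -/
theorem exists_rootMultiplicity_eq (n : ℕ) (hn : 1 ≤ n) (a : ℝ) {i : ℕ} (hi : i ≤ n) :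
    ∃ (t : ℕ → ℝ) (ω : ℝ), t n ≠ 0 ∧ (transferMatrixC n t ω).charpoly
      = (X ^ 2 + C (a : ℂ) * X + 1) ^ i * (X + 1) ^ (2 * (n - i)) := by
  let q : ℝ → ℝ[X] := fun a => C 1 * X ^ 2 + C a * X + C 1
  have hqd : ∀ a, (q a).natDegree = 2 := fun a => natDegree_quadratic one_ne_zero
  have hqm : ∀ a, (q a).Monic := fun a => by
    rw [Monic, leadingCoeff_quadratic one_ne_zero]
  have hqr : ∀ a, (q a).reverse = q a := fun a => by
    ext j
    rw [coeff_reverse, hqd]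
    rcases j with _ | _ | _ | j
    · rw [revAt_le (by norm_num)]; simp [q, coeff_X, coeff_one]
    · rw [revAt_le (by norm_num)]
    · rw [revAt_le (by norm_num)]; simp [q, coeff_X, coeff_one]
    · rw [revAt_eq_self_of_lt (by omega)]
  let Q := q a ^ i * q 2 ^ (n - i)
  have hQm : Q.Monic := ((hqm a).pow i).mul ((hqm 2).pow _)
  have hQd : Q.natDegree = 2 * n := by
    rw [((hqm a).pow i).natDegree_mul ((hqm 2).pow _), natDegree_pow, natDegree_pow, hqd, hqd]
    omega
  have hQr : Q.reverse = Q := by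
    rw [reverse_mul_of_domain, reverse_pow_eq_self (hqr a), reverse_pow_eq_self (hqr 2)]
  refine ⟨fun m => Q.coeff (n + m), Q.coeff n, ?_, ?_⟩
  · have : Q.coeff (n + n) = 1 := by
      rw [← two_mul, ← hQd]
      exact hQm
    simp only [this]
    norm_num
  · rw [charpoly_eq_of_reverse_eq n hn Q hQm hQd hQr]
    simp only [Q, q, Polynomial.map_mul, Polynomial.map_pow, Polynomial.map_add, map_X, map_C,
      Complex.ofRealHom_eq_coe, C_1, Polynomial.map_one, one_mul]
    rw [pow_mul]
    congr 2
    rw [Complex.ofReal_ofNat, map_ofNat]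
    ring

open Polynomial in
theorem rootMultiplicity_pow_mul {μ : ℂ} {R : ℂ[X]} (hR : R.eval μ ≠ 0) (p : ℕ) :
    ((X - C μ) ^ p * R).rootMultiplicity μ = p := by
  have hR0 : R ≠ 0 := fun h => hR (by rw [h, eval_zero])
  rw [rootMultiplicity_mul (mul_ne_zero (pow_ne_zero _ (X_sub_C_ne_zero _)) hR0),
    rootMultiplicity_X_sub_C_pow, rootMultiplicity_eq_zero hR, add_zero]

open Polynomial in
theorem exceptionalPoint_orders (n : ℕ) (hn : 1 ≤ n) :
    {p : ℕ | ∃ (t : ℕ → ℝ) (ω₀ : ℝ) (μ : ℂ), t n ≠ 0 ∧ ‖μ‖ = 1 ∧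
        IsExceptionalPoint (transferMatrixC n t ω₀) μ p}
      = {p : ℕ | (2 ≤ p ∧ p ≤ n) ∨ (n < p ∧ p ≤ 2 * n ∧ Even p)} := by
  ext p
  constructor
  · rintro ⟨t, ω, μ, ht, hμ, hEP⟩
    rw [isExceptionalPoint_iff n hn] at hEP
    obtain ⟨h2, hp⟩ := hEP
    by_cases hpn : p ≤ n
    · exact Or.inl ⟨h2, hpn⟩
    · refine Or.inr ⟨by omega, ?_, ?_⟩
      · rw [← hp]
        exact (Polynomial.count_roots _).symm.le.trans ((Multiset.count_le_card _ _).trans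
          ((Polynomial.card_roots' _).trans (natDegree_charpoly_transferMatrixC n t ω).le))
      · obtain ⟨k, rfl⟩ := exists_momentum hμ
        have hk : Real.sin k = 0 := by
          by_contra hk
          refine hpn (hp ▸ rootMultiplicity_le_of_im_ne_zero n t ω ?_)
          rw [exp_momentum_im]
          exact neg_ne_zero.2 hk
        rw [← hp]
        exact even_rootMultiplicity_of_sin_eq_zero n hn t ht ω hk
  · intro hp
    by_cases hpn : p ≤ n
    · have h2 : 2 ≤ p := by
        rcases hp with h | h
        · exact h.1
        · omega
      -- For `a = 0` the quadratic is `X² + 1`, with simple root `I`; the factors `X + 1` only fill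
      -- up the degree.
      obtain ⟨t, ω, ht, hP⟩ := exists_rootMultiplicity_eq n hn 0 hpn
      refine ⟨t, ω, Complex.I, ht, by simp, (isExceptionalPoint_iff n hn t ω _ p).2 ⟨h2, ?_⟩⟩
      have hfac : (X ^ 2 + C ((0 : ℝ) : ℂ) * X + 1) ^ p * (X + 1) ^ (2 * (n - p))
          = (X - C Complex.I) ^ p * ((X + C Complex.I) ^ p * (X + 1) ^ (2 * (n - p))) := by
        rw [← mul_assoc, ← mul_pow]
        congr 2
        have : C Complex.I * C Complex.I = -1 := by rw [← C_mul, Complex.I_mul_I, C_neg, C_1]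
        simp only [Complex.ofReal_zero, C_0]
        linear_combination this
      rw [hP, hfac, rootMultiplicity_pow_mul]
      simp only [eval_mul, eval_pow, eval_add, eval_X, eval_C, eval_one]
      refine mul_ne_zero (pow_ne_zero _ ?_) (pow_ne_zero _ ?_) <;> intro h
      · simpa using congrArg Complex.im h
      · simpa using congrArg Complex.im h
    · obtain ⟨-, h2n, q, hq⟩ : n < p ∧ p ≤ 2 * n ∧ Even p := by
        rcases hp with h | h
        · omega
        · exact h
      -- For `a = -2` the quadratic is `(X - 1)²`, so the even order `p = q + q` takes only `q ≤ n`
      -- quadratic factors.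
      obtain ⟨t, ω, ht, hP⟩ := exists_rootMultiplicity_eq n hn (-2) (i := q) (by omega)
      refine ⟨t, ω, 1, ht, by simp, (isExceptionalPoint_iff n hn t ω _ p).2 ⟨by omega, ?_⟩⟩
      have hfac : (X ^ 2 + C ((-2 : ℝ) : ℂ) * X + 1) ^ q * (X + 1) ^ (2 * (n - q))
          = (X - C (1 : ℂ)) ^ p * (X + 1) ^ (2 * (n - q)) := by
        rw [hq, ← two_mul, pow_mul (X - C (1 : ℂ))]
        congr 2
        have : C ((-2 : ℝ) : ℂ) = -2 := by
          rw [Complex.ofReal_neg, Complex.ofReal_ofNat, C_neg, map_ofNat]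
        rw [this, C_1]
        ring
      rw [hP, hfac, rootMultiplicity_pow_mul]
      simp only [eval_pow, eval_add, eval_X, eval_one]
      norm_num

theorem momentum_of_order_gt (n : ℕ) (hn : 1 ≤ n) (t : ℕ → ℝ) (ω₀ k₀ : ℝ) (p : ℕ)
    (hk₀ : k₀ ∈ Set.Icc (-Real.pi) Real.pi) (hEP : IsEPAtMomentum n t ω₀ k₀ p) (hp : n < p) :
    k₀ = 0 ∨ k₀ = Real.pi ∨ k₀ = -Real.pi := by
  have hsin : Real.sin k₀ = 0 := by
    by_contra hk
    have h1 := ((isExceptionalPoint_iff n hn t ω₀ _ p).1 hEP).2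
    have h2 := rootMultiplicity_le_of_im_ne_zero n t ω₀
      (μ := Complex.exp (-(Complex.I * (k₀ : ℂ))))
      (by rw [exp_momentum_im]; exact neg_ne_zero.2 hk)
    omega
  by_contra! hne
  rcases lt_trichotomy k₀ 0 with h | h | h
  · exact (Real.sin_neg_of_neg_of_neg_pi_lt h (lt_of_le_of_ne hk₀.1 hne.2.2.symm)).ne hsin
  · exact hne.1 h
  · exact (Real.sin_pos_of_pos_of_lt_pi h (lt_of_le_of_ne hk₀.2 hne.2.1)).ne' hsin

/-! ### Periodicity, level sets over one period, and unimodular eigenvalues. -/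

theorem periodic_dispersion (n : ℕ) (t : ℕ → ℝ) :
    Function.Periodic (dispersion n t) (2 * Real.pi) := by
  intro x
  unfold dispersion
  congr 1
  refine Finset.sum_congr rfl fun m _ => ?_
  rw [mul_add, Real.cos_add_nat_mul_two_pi]

theorem exp_momentum_periodic (k : ℝ) (j : ℤ) :
    Complex.exp (-(Complex.I * ((k + j * (2 * Real.pi) : ℝ) : ℂ)))
      = Complex.exp (-(Complex.I * (k : ℂ))) := by
  rw [Complex.exp_eq_exp_iff_exists_int]
  refine ⟨-j, ?_⟩
  push_cast
  ring

theorem exp_momentum_injOn (a : ℝ) :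
    Set.InjOn (fun k : ℝ => Complex.exp (-(Complex.I * (k : ℂ)))) (Set.Ico a (a + 2 * Real.pi)) := by
  intro x hx y hy hxy
  obtain ⟨j, hj⟩ := Complex.exp_eq_exp_iff_exists_int.1 hxy
  have h1 : x = y - j * (2 * Real.pi) := by
    have := congrArg Complex.im hj
    simp at this
    linarith
  have hpi := Real.pi_pos
  have h2 : (j : ℝ) < 1 := by
    by_contra! h
    nlinarith [hx.1, hy.2]
  have h3 : (-1 : ℝ) < j := by
    by_contra! h
    nlinarith [hx.2, hy.1]
  have h4 : j = 0 := by
    have h2' : j < 1 := by exact_mod_cast h2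
    have h3' : -1 < j := by exact_mod_cast h3
    omega
  rw [h1, h4]
  simp

theorem exists_momentum_mem_Ico (a k : ℝ) :
    ∃ k' ∈ Set.Ico a (a + 2 * Real.pi), ∃ j : ℤ, k = k' + j * (2 * Real.pi) := by
  refine ⟨toIcoMod Real.two_pi_pos a k, toIcoMod_mem_Ico _ _ _, toIcoDiv Real.two_pi_pos a k, ?_⟩
  rw [← zsmul_eq_mul, toIcoMod_add_toIcoDiv_zsmul]

/-- On a half-open period `k ↦ e^{-ik}` embeds the level set into the roots of the characteristic
polynomial. -/
theorem finite_level_set (n : ℕ) (hn : 1 ≤ n) (t : ℕ → ℝ) (ht : t n ≠ 0) (ω a : ℝ) :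
    {k | k ∈ Set.Icc a (a + 2 * Real.pi) ∧ dispersion n t k = ω}.Finite := by
  have h1 : {k | k ∈ Set.Ico a (a + 2 * Real.pi) ∧ dispersion n t k = ω}.Finite := by
    refine Set.Finite.of_finite_image (f := fun k : ℝ => Complex.exp (-(Complex.I * (k : ℂ)))) ?_
      ((exp_momentum_injOn a).mono fun k hk => hk.1)
    refine ((transferMatrixC n t ω).charpoly.roots.toFinset.finite_toSet).subset ?_
    rintro _ ⟨k, hk, rfl⟩
    rw [Finset.mem_coe, Multiset.mem_toFinset, Polynomial.mem_roots (Matrix.charpoly_monic _).ne_zero]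
    exact (eval_charpoly_exp_eq_zero_iff n hn t ht ω k).2 hk.2
  refine (h1.union (Set.finite_singleton (a + 2 * Real.pi))).subset fun k hk => ?_
  rcases hk.1.2.lt_or_eq with h | h
  · exact Or.inl ⟨⟨hk.1.1, h⟩, hk.2⟩
  · exact Or.inr h

/-- Supplies a base point `a` such that the period `[a, a + 2π]` has no zero of `ε - ω` at its ends,
which `[-π, π]` may well have. -/
theorem exists_dispersion_ne (n : ℕ) (hn : 1 ≤ n) (t : ℕ → ℝ) (ht : t n ≠ 0) (ω : ℝ) :
    ∃ a, dispersion n t a ≠ ω := by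
  by_contra! h
  refine (Set.Icc_infinite (by linarith [Real.two_pi_pos] : (0 : ℝ) < 0 + 2 * Real.pi))
    ((finite_level_set n hn t ht ω 0).subset fun k hk => ⟨hk, h k⟩)

/-- The integral of a periodic indicator function is the same over every period. -/
theorem integratedDOS_eq (n : ℕ) (t : ℕ → ℝ) (E a : ℝ) :
    integratedDOS n t E = MeasureTheory.volume.real
      {k | k ∈ Set.Icc a (a + 2 * Real.pi) ∧ dispersion n t k ≤ E} / (2 * Real.pi) := by
  have hmeas : MeasurableSet {k | dispersion n t k ≤ E} :=
    measurableSet_le (differentiable_dispersion n t).continuous.measurable measurable_const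
  have hper : Function.Periodic ({k | dispersion n t k ≤ E}.indicator (fun _ => (1 : ℝ)))
      (2 * Real.pi) := fun k => by
    simp only [Set.indicator, Set.mem_ofPred_eq, periodic_dispersion n t k]
  have key : ∀ c, MeasureTheory.volume.real
      {k | k ∈ Set.Icc c (c + 2 * Real.pi) ∧ dispersion n t k ≤ E}
      = ∫ k in c..(c + 2 * Real.pi), {k | dispersion n t k ≤ E}.indicator (fun _ => (1 : ℝ)) k := by
    intro c
    rw [intervalIntegral.integral_of_le (by linarith [Real.two_pi_pos]),
      ← MeasureTheory.integral_Icc_eq_integral_Ioc]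
    rw [MeasureTheory.integral_indicator_const _ hmeas,
      MeasureTheory.measureReal_restrict_apply hmeas, smul_eq_mul, mul_one, Set.inter_comm]
    rfl
  have h1 := key (-Real.pi)
  rw [hper.intervalIntegral_add_eq (-Real.pi) a, ← key a,
    show -Real.pi + 2 * Real.pi = Real.pi by ring] at h1
  rw [integratedDOS, ← h1]
  rfl

theorem rootMultiplicity_pos_iff (n : ℕ) (hn : 1 ≤ n) (t : ℕ → ℝ) (ht : t n ≠ 0) (ω k : ℝ) :
    0 < (transferMatrixC n t ω).charpoly.rootMultiplicity
      (Complex.exp (-(Complex.I * (k : ℂ)))) ↔ dispersion n t k = ω := by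
  rw [Polynomial.rootMultiplicity_pos (Matrix.charpoly_monic _).ne_zero]
  exact eval_charpoly_exp_eq_zero_iff n hn t ht ω k

/-- Near `k` the derivative is a convergent quotient times `x ^ (m - 1)`, which tends to `0` when `m
≥ 2`; continuity of `ε'` concludes. -/
theorem deriv_dispersion_eq_zero (n : ℕ) (hn : 1 ≤ n) (t : ℕ → ℝ) (ht : t n ≠ 0) (ω k : ℝ)
    (h2 : 2 ≤ (transferMatrixC n t ω).charpoly.rootMultiplicity
      (Complex.exp (-(Complex.I * (k : ℂ))))) : deriv (dispersion n t) k = 0 := by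
  obtain ⟨B, -, -, hlim⟩ := exists_leading_coeff n hn t ht ω k _ rfl
  set m := (transferMatrixC n t ω).charpoly.rootMultiplicity
      (Complex.exp (-(Complex.I * (k : ℂ))))
  have h1 : Tendsto (fun x : ℝ => x ^ (m - 1)) (𝓝[≠] 0) (𝓝 0) := by
    have : Tendsto (fun x : ℝ => x ^ (m - 1)) (𝓝 0) (𝓝 (0 ^ (m - 1))) :=
      (continuous_pow (m - 1)).tendsto 0
    rw [zero_pow (by omega)] at this
    exact this.mono_left nhdsWithin_le_nhds
  have h3 := (hlim (by omega)).mul h1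
  rw [mul_zero] at h3
  have h4 : Tendsto (fun x => deriv (dispersion n t) (k + x)) (𝓝[≠] 0)
      (𝓝 (deriv (dispersion n t) (k + 0))) :=
    (((continuous_deriv_dispersion n t).comp (continuous_const.add continuous_id)).tendsto
      0).mono_left nhdsWithin_le_nhds
  rw [add_zero] at h4
  refine tendsto_nhds_unique h4 (h3.congr' ?_)
  filter_upwards [self_mem_nhdsWithin] with x hx
  exact div_mul_cancel₀ _ (pow_ne_zero _ hx)

/-- At a regular level, the eigenvalues on the unit circle are simple and correspond to the
solutions of `ε(k) = E`. -/
theorem unitModulusCount_eq_ncard (n : ℕ) (hn : 1 ≤ n) (t : ℕ → ℝ) (ht : t n ≠ 0) (E a : ℝ)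
    (ha : dispersion n t a ≠ E)
    (hreg : ∀ k ∈ Set.Icc a (a + 2 * Real.pi), dispersion n t k = E →
      deriv (dispersion n t) k ≠ 0) :
    unitModulusCount n t E
      = {k | k ∈ Set.Icc a (a + 2 * Real.pi) ∧ dispersion n t k = E}.ncard := by
  classical
  set P := (transferMatrixC n t E).charpoly with hP
  have hP0 : P ≠ 0 := (Matrix.charpoly_monic _).ne_zero
  have hset : {k | k ∈ Set.Icc a (a + 2 * Real.pi) ∧ dispersion n t k = E}
      = {k | k ∈ Set.Ico a (a + 2 * Real.pi) ∧ dispersion n t k = E} := by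
    ext k
    refine ⟨fun hk => ⟨⟨hk.1.1, lt_of_le_of_ne hk.1.2 fun h => ha ?_⟩, hk.2⟩,
      fun hk => ⟨⟨hk.1.1, hk.1.2.le⟩, hk.2⟩⟩
    rw [← periodic_dispersion n t a, ← h]
    exact hk.2
  have hroot : ∀ μ ∈ P.roots.filter (fun μ : ℂ => ‖μ‖ = 1), ∃ k : ℝ,
      (k ∈ Set.Ico a (a + 2 * Real.pi) ∧ dispersion n t k = E) ∧
      Complex.exp (-(Complex.I * (k : ℂ))) = μ := by
    intro μ hμ
    rw [Multiset.mem_filter, Polynomial.mem_roots hP0] at hμ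
    obtain ⟨k, rfl⟩ := exists_momentum hμ.2
    obtain ⟨k', hk', j, rfl⟩ := exists_momentum_mem_Ico a k
    have h1 := hμ.1
    rw [exp_momentum_periodic] at h1 ⊢
    exact ⟨k', ⟨hk', (eval_charpoly_exp_eq_zero_iff n hn t ht E k').1 h1⟩, rfl⟩
  -- A repeated eigenvalue would make its momentum a critical point on the level, contrary to
  -- `hreg`.
  have hnodup : (P.roots.filter (fun μ : ℂ => ‖μ‖ = 1)).Nodup := by
    rw [Multiset.nodup_iff_count_le_one]
    intro μ
    by_contra! hlt
    have hmem : μ ∈ P.roots.filter (fun μ : ℂ => ‖μ‖ = 1) :=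
      Multiset.count_pos.1 (by omega)
    obtain ⟨k, ⟨hk, hkE⟩, rfl⟩ := hroot μ hmem
    have h2 := hlt.trans_le (Multiset.count_le_of_le _ (Multiset.filter_le _ _))
    rw [Polynomial.count_roots] at h2
    exact hreg k ⟨hk.1, hk.2.le⟩ hkE (deriv_dispersion_eq_zero n hn t ht E k h2)
  have himg : ((P.roots.filter (fun μ : ℂ => ‖μ‖ = 1)).toFinset : Set ℂ)
      = (fun k : ℝ => Complex.exp (-(Complex.I * (k : ℂ)))) ''
        {k | k ∈ Set.Ico a (a + 2 * Real.pi) ∧ dispersion n t k = E} := by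
    ext μ
    rw [Finset.mem_coe, Multiset.mem_toFinset]
    constructor
    · exact fun hμ => hroot μ hμ
    · rintro ⟨k, hk, rfl⟩
      rw [Multiset.mem_filter, Polynomial.mem_roots hP0]
      refine ⟨(eval_charpoly_exp_eq_zero_iff n hn t ht E k).2 hk.2, ?_⟩
      rw [Complex.norm_exp]
      simp
  rw [unitModulusCount, Multiset.countP_eq_card_filter, hset,
    ← ((exp_momentum_injOn a).mono fun k hk => hk.1).ncard_image, ← himg, Set.ncard_coe_finset,
    Multiset.toFinset_card_of_nodup hnodup]

/-! ### Nature of a critical point from its leading coefficient. -/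

theorem eventually_pos_of_leading_coeff {g : ℝ → ℝ} {m : ℕ} {B τ : ℝ} (hτ : τ = 1 ∨ τ = -1)
    (hlim : Tendsto (fun x => g x / x ^ m) (𝓝[≠] 0) (𝓝 B)) (hB : 0 < B * τ ^ m) :
    ∀ᶠ x in 𝓝[>] (0 : ℝ), 0 < g (τ * x) := by
  have hτ0 : τ ≠ 0 := by rcases hτ with rfl | rfl <;> norm_num
  have hdir : Tendsto (fun x : ℝ => τ * x) (𝓝[>] 0) (𝓝[≠] 0) := by
    rw [tendsto_nhdsWithin_iff]
    constructor
    · have : Tendsto (fun x : ℝ => τ * x) (𝓝 0) (𝓝 (τ * 0)) :=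
        (continuous_const.mul continuous_id).tendsto 0
      rw [mul_zero] at this
      exact this.mono_left nhdsWithin_le_nhds
    · filter_upwards [self_mem_nhdsWithin] with x hx
      exact mul_ne_zero hτ0 (ne_of_gt hx)
  have h1 := ((hlim.comp hdir).mul_const (τ ^ m)).eventually (lt_mem_nhds hB)
  filter_upwards [h1, self_mem_nhdsWithin] with x hx hx0
  have hx0' : (0 : ℝ) < x ^ m := pow_pos hx0 m
  have hτm : τ ^ m ≠ 0 := pow_ne_zero _ hτ0
  rw [Function.comp_apply, mul_pow] at hx
  have h2 : g (τ * x) / (τ ^ m * x ^ m) * τ ^ m = g (τ * x) / x ^ m := by field_simp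
  rw [h2] at hx
  exact (div_pos_iff_of_pos_right hx0').1 hx

/-- On the side `τ = ±1` the increment of `f` has the sign of `B * τ ^ m`, never zero; a minimum
needs both signs positive. -/
theorem isLocalMin_iff_of_leading_coeff {f : ℝ → ℝ} {z : ℝ} {m : ℕ} {B : ℝ} (hB : B ≠ 0)
    (hlim : Tendsto (fun x => (f (z + x) - f z) / x ^ m) (𝓝[≠] 0) (𝓝 B)) :
    IsLocalMin f z ↔ Even m ∧ 0 < B := by
  constructor
  · intro hmin
    have hside : ∀ τ : ℝ, τ = 1 ∨ τ = -1 → 0 < B * τ ^ m := by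
      intro τ hτ
      have hτm : τ ^ m ≠ 0 := pow_ne_zero _ (by rcases hτ with rfl | rfl <;> norm_num)
      by_contra hneg
      have hneg' : 0 < -B * τ ^ m := by
        have := lt_of_le_of_ne (not_lt.1 hneg) (mul_ne_zero hB hτm)
        linarith
      have h1 : Tendsto (fun x => -(f (z + x) - f z) / x ^ m) (𝓝[≠] 0) (𝓝 (-B)) :=
        hlim.neg.congr fun x => (neg_div _ _).symm
      have h2 := eventually_pos_of_leading_coeff hτ h1 hneg'
      have h3 : Tendsto (fun x : ℝ => z + τ * x) (𝓝[>] 0) (𝓝 z) := by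
        have : Tendsto (fun x : ℝ => z + τ * x) (𝓝 0) (𝓝 (z + τ * 0)) :=
          (continuous_const.add (continuous_const.mul continuous_id)).tendsto 0
        rw [mul_zero, add_zero] at this
        exact this.mono_left nhdsWithin_le_nhds
      obtain ⟨x, hx1, hx2⟩ := (h2.and (h3.eventually hmin)).exists
      linarith
    have hB1 : 0 < B := by simpa using hside 1 (Or.inl rfl)
    refine ⟨?_, hB1⟩
    by_contra hm
    rw [Nat.not_even_iff_odd] at hm
    have := hside (-1) (Or.inr rfl)
    rw [hm.neg_one_pow] at this
    linarith
  · rintro ⟨hm, hB⟩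
    have h1 := hlim.eventually (lt_mem_nhds hB)
    rw [eventually_nhdsWithin_iff] at h1
    have h2 : Tendsto (fun y => y - z) (𝓝 z) (𝓝 0) := by
      have : Tendsto (fun y : ℝ => y - z) (𝓝 z) (𝓝 (z - z)) :=
        (continuous_id.sub continuous_const).tendsto z
      rwa [sub_self] at this
    filter_upwards [h2.eventually h1] with y hy
    by_cases hyz : y = z
    · rw [hyz]
    · have h3 := hy (sub_ne_zero.2 hyz)
      rw [add_sub_cancel] at h3
      have h4 : 0 < (y - z) ^ m := hm.pow_pos (sub_ne_zero.2 hyz)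
      have := (div_pos_iff_of_pos_right h4).1 h3
      linarith

theorem isLocalMax_iff_of_leading_coeff {f : ℝ → ℝ} {z : ℝ} {m : ℕ} {B : ℝ} (hB : B ≠ 0)
    (hlim : Tendsto (fun x => (f (z + x) - f z) / x ^ m) (𝓝[≠] 0) (𝓝 B)) :
    IsLocalMax f z ↔ Even m ∧ B < 0 := by
  have h1 : Tendsto (fun x => ((-f) (z + x) - (-f) z) / x ^ m) (𝓝[≠] 0) (𝓝 (-B)) := by
    refine hlim.neg.congr fun x => ?_
    rw [Pi.neg_apply, Pi.neg_apply, ← neg_div]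
    congr 1
    ring
  have h2 := isLocalMin_iff_of_leading_coeff (neg_ne_zero.2 hB) h1
  rw [neg_pos] at h2
  rw [← h2]
  exact ⟨fun h => h.neg, fun h => by simpa using h.neg⟩

/-! ### Comparing the numbers of branches above and below the level. -/

theorem mem_branches {Z : Finset ℝ} {m : ℝ → ℕ} {B : ℝ → ℝ} {s : ℝ} {b : ℝ × ℝ} :
    b ∈ branches Z m B s ↔ b.1 ∈ Z ∧ (b.2 = 1 ∨ b.2 = -1) ∧ branchSign m B b = s := by
  rw [branches, Finset.mem_filter, Finset.mem_product, Finset.mem_insert, Finset.mem_singleton,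
    and_assoc]

theorem branchSign_eq_iff {m : ℝ → ℕ} {B : ℝ → ℝ} {s : ℝ} {b : ℝ × ℝ} (hs : s = 1 ∨ s = -1)
    (hB : B b.1 ≠ 0) (hb : b.2 = 1 ∨ b.2 = -1) :
    branchSign m B b = s ↔ 0 < s * (B b.1 * b.2 ^ m b.1) := by
  have h := branchSign_mul_pos (m := m) hB hb
  constructor
  · rintro rfl
    exact h
  · intro h'
    rcases branchSign_eq_or m B b with h1 | h1 <;> rcases hs with rfl | rfl <;> rw [h1] at h ⊢ <;>
      linarith

/-- At a zero of odd order, reversing the direction reverses the sign of the branch. -/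
theorem image_branches_subset {Z : Finset ℝ} {m : ℝ → ℕ} {B : ℝ → ℝ} (hB : ∀ z ∈ Z, B z ≠ 0)
    {s : ℝ} (hs : s = 1 ∨ s = -1) (hodd : ∀ b ∈ branches Z m B (-s), Odd (m b.1)) :
    (branches Z m B (-s)).image (fun b => (b.1, -b.2)) ⊆ branches Z m B s := by
  intro b hb
  obtain ⟨⟨z, τ⟩, hb', rfl⟩ := Finset.mem_image.1 hb
  have ho := hodd _ hb'
  rw [mem_branches] at hb' ⊢
  obtain ⟨h1, h2, h3⟩ := hb'
  have hs' : -s = 1 ∨ -s = -1 := by rcases hs with rfl | rfl <;> simp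
  have h2' : -τ = 1 ∨ -τ = -1 := by rcases h2 with h | h <;> simp only at h <;> rw [h] <;> simp
  refine ⟨h1, h2', ?_⟩
  rw [branchSign_eq_iff hs' (hB z h1) h2] at h3
  rw [branchSign_eq_iff hs (hB z h1) h2']
  simp only at h3 ho ⊢
  rw [ho.neg_pow]
  linarith

theorem card_image_branches (Z : Finset ℝ) (m : ℝ → ℕ) (B : ℝ → ℝ) (s : ℝ) :
    ((branches Z m B s).image (fun b => (b.1, -b.2))).card = (branches Z m B s).card :=
  Finset.card_image_of_injective _ fun b b' h => by
    have h1 := congrArg Prod.fst h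
    have h2 := congrArg Prod.snd h
    exact Prod.ext h1 (neg_injective h2)

theorem card_branches_le {Z : Finset ℝ} {m : ℝ → ℕ} {B : ℝ → ℝ} (hB : ∀ z ∈ Z, B z ≠ 0)
    {s : ℝ} (hs : s = 1 ∨ s = -1) (hodd : ∀ b ∈ branches Z m B (-s), Odd (m b.1)) :
    (branches Z m B (-s)).card ≤ (branches Z m B s).card := by
  rw [← card_image_branches]
  exact Finset.card_le_card (image_branches_subset hB hs hodd)

/-- At `z₀` the order is even, so the branch `(z₀, 1)` has sign `s` but is not the reversal of a
branch of sign `-s`. -/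
theorem card_branches_lt {Z : Finset ℝ} {m : ℝ → ℕ} {B : ℝ → ℝ} (hB : ∀ z ∈ Z, B z ≠ 0)
    {s : ℝ} (hs : s = 1 ∨ s = -1) (hodd : ∀ b ∈ branches Z m B (-s), Odd (m b.1))
    {z₀ : ℝ} (hz₀ : z₀ ∈ Z) (heven : Even (m z₀)) (hsB : 0 < s * B z₀) :
    (branches Z m B (-s)).card < (branches Z m B s).card := by
  rw [← card_image_branches]
  refine Finset.card_lt_card ((Finset.ssubset_iff_of_subset (image_branches_subset hB hs hodd)).2
    ⟨(z₀, 1), ?_, ?_⟩)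
  · rw [mem_branches]
    refine ⟨hz₀, Or.inl rfl, ?_⟩
    rw [branchSign_eq_iff hs (hB z₀ hz₀) (Or.inl rfl)]
    simpa using hsB
  · intro h
    obtain ⟨b, hb, hbz⟩ := Finset.mem_image.1 h
    have h1 := hodd b hb
    have h2 : b.1 = z₀ := congrArg Prod.fst hbz
    rw [h2] at h1
    exact (Nat.not_even_iff_odd.2 h1) heven

/-! ### Asymptotics of the density of states. -/

/-- Makes every bounded contribution negligible against `δ^{-(p-1)/p}`. The exponent is strictly
negative because `p ≥ 2`. -/
theorem tendsto_inv_rpow_exponent {p : ℕ} (hp : 2 ≤ p) :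
    Tendsto (fun δ : ℝ => (δ ^ (-((p : ℝ) - 1) / (p : ℝ)))⁻¹) (𝓝[>] 0) (𝓝 0) := by
  have hp' : (2 : ℝ) ≤ p := by exact_mod_cast hp
  have he : 0 < ((p : ℝ) - 1) / p := div_pos (by linarith) (by linarith)
  have h1 : Tendsto (fun δ : ℝ => δ ^ (((p : ℝ) - 1) / p)) (𝓝 0) (𝓝 0) := by
    have := (Real.continuous_rpow_const he.le).tendsto 0
    rwa [Real.zero_rpow he.ne'] at this
  refine (h1.mono_left nhdsWithin_le_nhds).congr' ?_
  filter_upwards [self_mem_nhdsWithin] with δ hδ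
  rw [neg_div, Real.rpow_neg (le_of_lt hδ), inv_inv]

theorem not_dosFinite_of_dosDiverges {n : ℕ} {t : ℕ → ℝ} {ω₀ σ : ℝ} {p : ℕ} (hp : 2 ≤ p)
    (h : DOSDiverges n t ω₀ σ p) : ¬ DOSFinite n t ω₀ σ := by
  rintro ⟨-, L, hL⟩
  obtain ⟨-, C, hC, hlim⟩ := h
  have h1 := hL.mul (tendsto_inv_rpow_exponent hp)
  rw [mul_zero] at h1
  exact hC.ne' (tendsto_nhds_unique hlim (h1.congr fun δ => (div_eq_mul_inv _ _).symm))

section DensityOfStates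

variable {n : ℕ} {t : ℕ → ℝ} {ω₀ s : ℝ} {S : Finset (ℝ × ℝ)} {h : ℝ × ℝ → ℝ → ℝ} {c K : ℝ}

/-- The sign `s` enters twice, as the coefficient of the sum and through `δ = s (E - ω₀)`; the two
factors cancel, so `ν` is a sum of the `h'` on either side. -/
theorem hasDerivAt_integratedDOS (hs : s = 1 ∨ s = -1)
    (hdiff : ∀ b ∈ S, ∀ δ ∈ Set.Ioo 0 c, DifferentiableAt ℝ (h b) δ)
    (hD : ∀ δ ∈ Set.Ioo 0 c, integratedDOS n t (ω₀ + s * δ)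
      = (K + s * ∑ b ∈ S, h b δ) / (2 * Real.pi)) :
    ∀ δ ∈ Set.Ioo 0 c, HasDerivAt (integratedDOS n t)
      ((∑ b ∈ S, deriv (h b) δ) / (2 * Real.pi)) (ω₀ + s * δ) := by
  intro δ hδ
  have hss : s * s = 1 := by rcases hs with rfl | rfl <;> norm_num
  have hval : s * (ω₀ + s * δ - ω₀) = δ := by linear_combination δ * hss
  have hin : HasDerivAt (fun E => s * (E - ω₀)) s (ω₀ + s * δ) := by
    simpa using ((hasDerivAt_id (ω₀ + s * δ)).sub_const ω₀).const_mul s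
  have hsum : HasDerivAt (fun E => (K + s * ∑ b ∈ S, h b (s * (E - ω₀))) / (2 * Real.pi))
      ((∑ b ∈ S, deriv (h b) δ) / (2 * Real.pi)) (ω₀ + s * δ) := by
    have h1 : ∀ b ∈ S, HasDerivAt (fun E => h b (s * (E - ω₀))) (deriv (h b) δ * s)
        (ω₀ + s * δ) := fun b hb => by
      have h2 : HasDerivAt (h b) (deriv (h b) δ) (s * (ω₀ + s * δ - ω₀)) := by
        rw [hval]
        exact (hdiff b hb δ hδ).hasDerivAt
      exact h2.comp (ω₀ + s * δ) hin
    refine ((((HasDerivAt.fun_sum h1).const_mul s).const_add K).div_const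
      (2 * Real.pi)).congr_deriv ?_
    rw [← Finset.sum_mul]
    congr 1
    linear_combination (∑ b ∈ S, deriv (h b) δ) * hss
  refine hsum.congr_of_eventuallyEq ?_
  have hnear : ∀ᶠ E in 𝓝 (ω₀ + s * δ), s * (E - ω₀) ∈ Set.Ioo 0 c := by
    have h3 := hin.continuousAt
    have h4 : Set.Ioo 0 c ∈ 𝓝 (s * (ω₀ + s * δ - ω₀)) := by
      rw [hval]
      exact isOpen_Ioo.mem_nhds hδ
    exact h3.eventually h4
  filter_upwards [hnear] with E hE
  rw [← hD _ hE]
  congr 1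
  linear_combination -(E - ω₀) * hss

theorem dosFinite_of_branches (hc : 0 < c)
    (hderiv : ∀ δ ∈ Set.Ioo 0 c, HasDerivAt (integratedDOS n t)
      ((∑ b ∈ S, deriv (h b) δ) / (2 * Real.pi)) (ω₀ + s * δ))
    {m : ℝ → ℕ} (hasym : ∀ b ∈ S, ∃ C : ℝ, 0 < C ∧ Tendsto
      (fun δ => deriv (h b) δ / δ ^ (-((m b.1 : ℝ) - 1) / (m b.1 : ℝ))) (𝓝[>] 0) (𝓝 C))
    (hm : ∀ b ∈ S, m b.1 = 1) : DOSFinite n t ω₀ s := by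
  have hev : ∀ᶠ δ in 𝓝[>] (0 : ℝ), δ ∈ Set.Ioo 0 c := Ioo_mem_nhdsGT hc
  refine ⟨hev.mono fun δ hδ => (hderiv δ hδ).differentiableAt, ?_⟩
  choose! C _ hlim using hasym
  refine ⟨(∑ b ∈ S, C b) / (2 * Real.pi), ?_⟩
  have h1 : Tendsto (fun δ => (∑ b ∈ S, deriv (h b) δ) / (2 * Real.pi)) (𝓝[>] 0)
      (𝓝 ((∑ b ∈ S, C b) / (2 * Real.pi))) := by
    refine (tendsto_finsetSum _ fun b hb => ?_).div_const _
    refine (hlim b hb).congr fun δ => ?_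
    rw [hm b hb]
    simp
  refine h1.congr' (hev.mono fun δ hδ => ?_)
  exact (hderiv δ hδ).deriv.symm

/-- After division by `δ^{-(p-1)/p}` simple branches tend to `0` and branches of order `p` to
positive constants, so nothing can cancel. -/
theorem dosDiverges_of_branches (hc : 0 < c)
    (hderiv : ∀ δ ∈ Set.Ioo 0 c, HasDerivAt (integratedDOS n t)
      ((∑ b ∈ S, deriv (h b) δ) / (2 * Real.pi)) (ω₀ + s * δ))
    {m : ℝ → ℕ} (hasym : ∀ b ∈ S, ∃ C : ℝ, 0 < C ∧ Tendsto
      (fun δ => deriv (h b) δ / δ ^ (-((m b.1 : ℝ) - 1) / (m b.1 : ℝ))) (𝓝[>] 0) (𝓝 C))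
    {p : ℕ} (hp : 2 ≤ p) (hm : ∀ b ∈ S, m b.1 = 1 ∨ m b.1 = p) (hex : ∃ b ∈ S, m b.1 = p) :
    DOSDiverges n t ω₀ s p := by
  have hev : ∀ᶠ δ in 𝓝[>] (0 : ℝ), δ ∈ Set.Ioo 0 c := Ioo_mem_nhdsGT hc
  refine ⟨hev.mono fun δ hδ => (hderiv δ hδ).differentiableAt, ?_⟩
  have hasym' : ∀ b ∈ S, ∃ C : ℝ, 0 ≤ C ∧ (m b.1 = p → 0 < C) ∧ Tendsto
      (fun δ => deriv (h b) δ / δ ^ (-((p : ℝ) - 1) / (p : ℝ))) (𝓝[>] 0) (𝓝 C) := by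
    intro b hb
    obtain ⟨C, hC, hlim⟩ := hasym b hb
    rcases hm b hb with h1 | h1
    · refine ⟨0, le_rfl, fun h2 => by omega, ?_⟩
      have h3 := hlim.mul (tendsto_inv_rpow_exponent hp)
      rw [mul_zero] at h3
      refine h3.congr fun δ => ?_
      rw [h1]
      simp [div_eq_mul_inv]
    · exact ⟨C, hC.le, fun _ => hC, by rwa [h1] at hlim⟩
  choose! C hC0 hC hlim using hasym'
  refine ⟨(∑ b ∈ S, C b) / (2 * Real.pi), ?_, ?_⟩
  · obtain ⟨b, hb, hbp⟩ := hex
    exact div_pos (Finset.sum_pos' hC0 ⟨b, hb, hC b hb hbp⟩) Real.two_pi_pos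
  · refine ((tendsto_finsetSum _ hlim).div_const (2 * Real.pi)).congr' (hev.mono fun δ hδ => ?_)
    have hν : densityOfStates n t (ω₀ + s * δ) = (∑ b ∈ S, deriv (h b) δ) / (2 * Real.pi) :=
      (hderiv δ hδ).deriv
    simp only [hν, ← Finset.sum_div]
    ring

end DensityOfStates

/-! ### Assembly of the three alternatives and of the theorem. -/

/-- Index, nature of the critical point and behaviour of the density of states, in terms of the
parity of the order and the sign of the leading coefficient. -/
theorem exceptionalPoint_trichotomy (n : ℕ) (hn : 1 ≤ n) (t : ℕ → ℝ) (ω₀ k₀ : ℝ) (p : ℕ)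
    (ht : t n ≠ 0) (hEP : IsEPAtMomentum n t ω₀ k₀ p)
    (hall : ∀ (k : ℝ) (q : ℕ), k ∈ Set.Icc (-Real.pi) Real.pi → IsEPAtMomentum n t ω₀ k q →
      q = p ∧ (IsLocalMin (dispersion n t) k ↔ IsLocalMin (dispersion n t) k₀)) :
    HasDerivAt (dispersion n t) 0 k₀ ∧ ∃ I : SignType,
      (∀ᶠ δ in 𝓝[>] (0 : ℝ), transferIndex n t ω₀ δ = I) ∧
      ((Odd p ∧ I = 0 ∧ ¬ IsLocalMin (dispersion n t) k₀ ∧ ¬ IsLocalMax (dispersion n t) k₀ ∧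
          DOSDiverges n t ω₀ 1 p ∧ DOSDiverges n t ω₀ (-1) p) ∨
        (Even p ∧ I = 1 ∧ IsLocalMin (dispersion n t) k₀ ∧ ¬ IsLocalMax (dispersion n t) k₀ ∧
          DOSDiverges n t ω₀ 1 p ∧ DOSFinite n t ω₀ (-1)) ∨
        (Even p ∧ I = -1 ∧ ¬ IsLocalMin (dispersion n t) k₀ ∧ IsLocalMax (dispersion n t) k₀ ∧
          DOSDiverges n t ω₀ (-1) p ∧ DOSFinite n t ω₀ 1)) := by
  obtain ⟨hp2, hpk₀⟩ := (isExceptionalPoint_iff n hn t ω₀ _ p).1 hEP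
  have hcritical : HasDerivAt (dispersion n t) 0 k₀ := by
    have h1 := (differentiable_dispersion n t k₀).hasDerivAt
    rwa [deriv_dispersion_eq_zero n hn t ht ω₀ k₀ (by rw [hpk₀]; exact hp2)] at h1
  refine ⟨hcritical, ?_⟩
  obtain ⟨a, ha⟩ := exists_dispersion_ne n hn t ht ω₀
  let m : ℝ → ℕ := fun z => (transferMatrixC n t ω₀).charpoly.rootMultiplicity
    (Complex.exp (-(Complex.I * (z : ℂ))))
  choose B hB hlim hlim' using fun z => exists_leading_coeff n hn t ht ω₀ z (m z) rfl
  have hmpos : ∀ z, 1 ≤ m z ↔ dispersion n t z = ω₀ := rootMultiplicity_pos_iff n hn t ht ω₀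
  have hfin := finite_level_set n hn t ht ω₀ a
  set Z : Finset ℝ := hfin.toFinset with hZdef
  have hZ : ∀ z, z ∈ Z ↔ z ∈ Set.Icc a (a + 2 * Real.pi) ∧ dispersion n t z - ω₀ = 0 := fun z => by
    rw [hZdef, Set.Finite.mem_toFinset, sub_eq_zero]
    rfl
  have hZm : ∀ z ∈ Z, 1 ≤ m z := fun z hz => (hmpos z).2 (sub_eq_zero.1 ((hZ z).1 hz).2)
  have ha' : dispersion n t (a + 2 * Real.pi) ≠ ω₀ := by rwa [periodic_dispersion n t a]
  obtain ⟨h, c₁, hc₁, hbranch, hlevel⟩ := exists_branches (f := fun k => dispersion n t k - ω₀)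
    (f' := deriv (dispersion n t)) (a := a) (b := a + 2 * Real.pi) (Z := Z) (m := m) (B := B)
    (fun x => (differentiable_dispersion n t x).hasDerivAt.sub_const ω₀) hZ
    (sub_ne_zero.2 ha) (sub_ne_zero.2 ha') hZm (fun z _ => hB z) (fun z _ => hlim z)
    (fun z hz => hlim' z (hZm z hz))
  -- The second bound keeps the base point `a` off all levels `ω₀ ± δ` with `0 < δ < c`, as counting
  -- eigenvalues over one period requires.
  obtain ⟨c, hc, hcc₁, hca⟩ : ∃ c > 0, c ≤ c₁ ∧ c ≤ |dispersion n t a - ω₀| :=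
    ⟨min c₁ |dispersion n t a - ω₀|, lt_min hc₁ (abs_pos.2 (sub_ne_zero.2 ha)),
      min_le_left _ _, min_le_right _ _⟩
  have hIoo : ∀ δ ∈ Set.Ioo 0 c, δ ∈ Set.Ioo 0 c₁ := fun δ hδ => ⟨hδ.1, hδ.2.trans_le hcc₁⟩
  have hev : ∀ᶠ δ in 𝓝[>] (0 : ℝ), δ ∈ Set.Ioo 0 c := Ioo_mem_nhdsGT hc
  -- translates by a period share their multiplicity and leading coefficient
  have hmper : ∀ (z : ℝ) (j : ℤ), m (z + j * (2 * Real.pi)) = m z := fun z j => by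
    simp only [m, exp_momentum_periodic]
  have hdper : ∀ (x : ℝ) (j : ℤ), dispersion n t (x + j * (2 * Real.pi)) = dispersion n t x :=
    fun x j => (periodic_dispersion n t).int_mul j x
  have hlimper : ∀ z ∈ Z, ∀ j : ℤ, Tendsto (fun x => (dispersion n t (z + j * (2 * Real.pi) + x)
      - dispersion n t (z + j * (2 * Real.pi))) / x ^ m z) (𝓝[≠] 0) (𝓝 (B z)) := fun z hz j => by
    refine (hlim z).congr fun x => ?_
    rw [add_right_comm, hdper, hdper, sub_eq_zero.1 ((hZ z).1 hz).2]
  have hmin : ∀ z ∈ Z, ∀ j : ℤ, IsLocalMin (dispersion n t) (z + j * (2 * Real.pi)) ↔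
      Even (m z) ∧ 0 < B z := fun z hz j =>
    isLocalMin_iff_of_leading_coeff (hB z) (hlimper z hz j)
  have hmax : ∀ z ∈ Z, ∀ j : ℤ, IsLocalMax (dispersion n t) (z + j * (2 * Real.pi)) ↔
      Even (m z) ∧ B z < 0 := fun z hz j =>
    isLocalMax_iff_of_leading_coeff (hB z) (hlimper z hz j)
  obtain ⟨z₀, hz₀, j₀, hk₀z₀⟩ : ∃ z₀ ∈ Z, ∃ j : ℤ, k₀ = z₀ + j * (2 * Real.pi) := by
    obtain ⟨z₀, hz₀, j, hj⟩ := exists_momentum_mem_Ico a k₀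
    refine ⟨z₀, (hZ z₀).2 ⟨⟨hz₀.1, hz₀.2.le⟩, ?_⟩, j, hj⟩
    have h1 : dispersion n t k₀ = ω₀ := (hmpos k₀).1 (by simp only [m, hpk₀]; omega)
    rw [hj, hdper] at h1
    exact sub_eq_zero.2 h1
  have hmz₀ : m z₀ = p := by
    rw [← hmper z₀ j₀, ← hk₀z₀]
    exact hpk₀
  have hmin₀ : IsLocalMin (dispersion n t) k₀ ↔ Even p ∧ 0 < B z₀ := by
    rw [hk₀z₀, hmin z₀ hz₀ j₀, hmz₀]
  have hmax₀ : IsLocalMax (dispersion n t) k₀ ↔ Even p ∧ B z₀ < 0 := by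
    rw [hk₀z₀, hmax z₀ hz₀ j₀, hmz₀]
  -- A multiple zero in the period starting at `a` is a translate of a momentum in `[-π, π)`, where
  -- `hall` applies; for even `p` being a minimum is the sign of the leading coefficient.
  have horder : ∀ z ∈ Z, m z = 1 ∨ (m z = p ∧ (Even p → (0 < B z ↔ 0 < B z₀))) := by
    intro z hz
    by_cases h1 : m z = 1
    · exact Or.inl h1
    · obtain ⟨k, hk, j, hj⟩ := exists_momentum_mem_Ico (-Real.pi) z
      have hk' : k = z + (-j : ℤ) * (2 * Real.pi) := by rw [hj]; push_cast; ring
      have hmk : m k = m z := by rw [hk', hmper]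
      have hkEP : IsEPAtMomentum n t ω₀ k (m z) :=
        (isExceptionalPoint_iff n hn t ω₀ _ _).2 ⟨by have := hZm z hz; omega, hmk⟩
      obtain ⟨h2, h3⟩ := hall k (m z) ⟨hk.1, by linarith [hk.2]⟩ hkEP
      refine Or.inr ⟨h2, fun he => ?_⟩
      rw [hmin₀, hk', hmin z hz, h2] at h3
      simpa [he] using h3
  have hcount : ∀ s : ℝ, s = 1 ∨ s = -1 → ∀ δ ∈ Set.Ioo 0 c,
      unitModulusCount n t (ω₀ + s * δ) = (branches Z m B s).card := by
    intro s hs δ hδ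
    obtain ⟨h1, h2⟩ := (hlevel s hs).2 δ (hIoo δ hδ)
    have hiff : ∀ k, dispersion n t k - ω₀ = s * δ ↔ dispersion n t k = ω₀ + s * δ := fun k =>
      sub_eq_iff_eq_add'
    simp only [hiff] at h1 h2
    rw [unitModulusCount_eq_ncard n hn t ht _ a _ h2, h1]
    intro h3
    rw [h3, add_sub_cancel_left, abs_mul, abs_of_pos hδ.1] at hca
    have : |s| = 1 := by rcases hs with rfl | rfl <;> simp
    rw [this, one_mul] at hca
    linarith [hδ.2]
  have hindex : ∀ᶠ δ in 𝓝[>] (0 : ℝ), transferIndex n t ω₀ δ = SignType.sign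
      (((branches Z m B 1).card : ℤ) - ((branches Z m B (-1)).card : ℤ)) := by
    filter_upwards [hev] with δ hδ
    have h1 := hcount 1 (Or.inl rfl) δ hδ
    have h2 := hcount (-1) (Or.inr rfl) δ hδ
    rw [one_mul] at h1
    rw [neg_one_mul, ← sub_eq_add_neg] at h2
    rw [transferIndex, h1, h2]
  have hmemZ : ∀ s, ∀ b ∈ branches Z m B s, b.1 ∈ Z := fun s b hb => (mem_branches.1 hb).1
  have hderiv : ∀ s : ℝ, s = 1 ∨ s = -1 → ∀ δ ∈ Set.Ioo 0 c, HasDerivAt (integratedDOS n t)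
      ((∑ b ∈ branches Z m B s, deriv (h b) δ) / (2 * Real.pi)) (ω₀ + s * δ) := by
    intro s hs
    obtain ⟨K, hK⟩ := (hlevel s hs).1
    refine hasDerivAt_integratedDOS (K := K) hs (fun b hb δ hδ => ?_) fun δ hδ => ?_
    · exact (hbranch b (Finset.mem_filter.1 hb).1).1 δ (hIoo δ hδ)
    · rw [integratedDOS_eq n t _ a, ← hK δ (hIoo δ hδ)]
      simp only [sub_le_iff_le_add']
  have hasym := fun s (b : ℝ × ℝ) (hb : b ∈ branches Z m B s) =>
    (hbranch b (Finset.mem_filter.1 hb).1).2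
  have hfinite : ∀ s : ℝ, s = 1 ∨ s = -1 → (∀ b ∈ branches Z m B s, m b.1 = 1) →
      DOSFinite n t ω₀ s := fun s hs hm =>
    dosFinite_of_branches hc (hderiv s hs) (hasym s) hm
  have hdiv : ∀ s : ℝ, s = 1 ∨ s = -1 → (∃ τ : ℝ, (τ = 1 ∨ τ = -1) ∧ 0 < s * (B z₀ * τ ^ p)) →
      DOSDiverges n t ω₀ s p := by
    rintro s hs ⟨τ, hτ, hpos⟩
    refine dosDiverges_of_branches hc (hderiv s hs) (hasym s) hp2
      (fun b hb => (horder b.1 (hmemZ s b hb)).imp id fun h => h.1) ⟨(z₀, τ), ?_, hmz₀⟩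
    refine mem_branches.2 ⟨hz₀, hτ, (branchSign_eq_iff hs (hB z₀) hτ).2 ?_⟩
    simp only [hmz₀]
    exact hpos
  -- for even order, all branches on the side away from the extremum are simple
  have hsimple : Even p → ∀ s : ℝ, s = 1 ∨ s = -1 → 0 < s * B z₀ →
      ∀ b ∈ branches Z m B (-s), m b.1 = 1 := by
    intro he s hs hsB b hb
    have hbZ := hmemZ _ b hb
    refine (horder b.1 hbZ).resolve_right fun ⟨h1, h2⟩ => ?_
    obtain ⟨-, hτ, hsgn⟩ := mem_branches.1 hb
    have hs' : -s = 1 ∨ -s = -1 := by rcases hs with rfl | rfl <;> simp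
    rw [branchSign_eq_iff hs' (hB _) hτ, h1] at hsgn
    have hτp : b.2 ^ p = 1 := by rcases hτ with h | h <;> rw [h] <;> simp [he]
    rw [hτp, mul_one] at hsgn
    have h3 := h2 he
    have h4 := hB b.1
    rcases hs with rfl | rfl
    · have := h3.2 (by linarith)
      linarith
    · have := h3.1 (by linarith)
      linarith
  have hB₀ := hB z₀
  rcases Nat.even_or_odd p with he | ho
  · rcases lt_or_gt_of_ne hB₀ with hneg | hpos
    · have hs1 : 0 < (-1 : ℝ) * B z₀ := by linarith
      have h1 := hsimple he (-1) (Or.inr rfl) hs1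
      have hlt := card_branches_lt (Z := Z) (m := m) (B := B) (fun z _ => hB z) (Or.inr rfl)
        (fun b hb => by rw [h1 b hb]; exact odd_one) hz₀ (hmz₀ ▸ he) hs1
      rw [neg_neg] at h1 hlt
      refine ⟨-1, hindex.mono fun δ hδ => ?_, Or.inr (Or.inr ⟨he, rfl, ?_, hmax₀.2 ⟨he, hneg⟩,
        hdiv _ (Or.inr rfl) ⟨1, Or.inl rfl, by simpa using hneg⟩, hfinite 1 (Or.inl rfl) h1⟩)⟩
      · rw [hδ]
        exact sign_neg (by omega)
      · rw [hmin₀]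
        exact fun h => lt_asymm h.2 hneg
    · have hs1 : 0 < (1 : ℝ) * B z₀ := by linarith
      have h1 := hsimple he 1 (Or.inl rfl) hs1
      have hlt := card_branches_lt (Z := Z) (m := m) (B := B) (fun z _ => hB z) (Or.inl rfl)
        (fun b hb => by rw [h1 b hb]; exact odd_one) hz₀ (hmz₀ ▸ he) hs1
      refine ⟨1, hindex.mono fun δ hδ => ?_, Or.inr (Or.inl ⟨he, rfl, hmin₀.2 ⟨he, hpos⟩, ?_,
        hdiv _ (Or.inl rfl) ⟨1, Or.inl rfl, by simpa using hpos⟩, hfinite _ (Or.inr rfl) h1⟩)⟩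
      · rw [hδ]
        exact sign_pos (by omega)
      · rw [hmax₀]
        exact fun h => lt_asymm h.2 hpos
  -- For odd `p` every zero has odd order, simple ones included, so reversal of branches gives both
  -- inequalities and the counts agree.
  · have hodd : ∀ s, ∀ b ∈ branches Z m B s, Odd (m b.1) := fun s b hb => by
      rcases horder b.1 (hmemZ s b hb) with h1 | h1
      · rw [h1]; exact odd_one
      · rw [h1.1]; exact ho
    have hne : ¬ Even p := Nat.not_even_iff_odd.2 ho
    have hle1 := card_branches_le (Z := Z) (fun z _ => hB z) (Or.inl rfl) (hodd (-1))
    have hle2 := card_branches_le (Z := Z) (fun z _ => hB z) (s := -1) (Or.inr rfl) (hodd _)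
    rw [neg_neg] at hle2
    -- For odd order one of the two directions at `z₀` has sign `s`, whichever `s` is, so `ν`
    -- diverges on both sides.
    have hboth : ∀ s : ℝ, s = 1 ∨ s = -1 →
        ∃ τ : ℝ, (τ = 1 ∨ τ = -1) ∧ 0 < s * (B z₀ * τ ^ p) := by
      intro s hs
      have hsB : s * B z₀ ≠ 0 :=
        mul_ne_zero (by rcases hs with rfl | rfl <;> norm_num) hB₀
      rcases lt_or_gt_of_ne hsB with h1 | h1
      · refine ⟨-1, Or.inr rfl, ?_⟩
        rw [ho.neg_one_pow]
        linarith
      · exact ⟨1, Or.inl rfl, by simpa using h1⟩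
    refine ⟨0, hindex.mono fun δ hδ => ?_, Or.inl ⟨ho, rfl, fun h => hne (hmin₀.1 h).1,
      fun h => hne (hmax₀.1 h).1, hdiv _ (Or.inl rfl) (hboth _ (Or.inl rfl)),
      hdiv _ (Or.inr rfl) (hboth _ (Or.inr rfl))⟩⟩
    rw [hδ, sign_eq_zero_iff]
    omega
theorem theorem2 (n : ℕ) (hn : 1 ≤ n) :
    -- (i)(a) the allowed orders for hopping range `n`
    {p : ℕ | ∃ (t : ℕ → ℝ) (ω₀ : ℝ) (μ : ℂ), t n ≠ 0 ∧ ‖μ‖ = 1 ∧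
        IsExceptionalPoint (transferMatrixC n t ω₀) μ p}
      = {p : ℕ | (2 ≤ p ∧ p ≤ n) ∨ (n < p ∧ p ≤ 2 * n ∧ Even p)} ∧
    -- (i)(b) orders larger than `n` occur only at `k = 0, ±π`
    (∀ (t : ℕ → ℝ) (ω₀ k₀ : ℝ) (p : ℕ), t n ≠ 0 → k₀ ∈ Set.Icc (-Real.pi) Real.pi →
      IsEPAtMomentum n t ω₀ k₀ p → n < p → k₀ = 0 ∨ k₀ = Real.pi ∨ k₀ = -Real.pi) ∧
    -- (ii) index, nature of the critical point, and divergence of the density of states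
    (∀ (t : ℕ → ℝ) (ω₀ k₀ : ℝ) (p : ℕ), t n ≠ 0 → k₀ ∈ Set.Icc (-Real.pi) Real.pi →
      IsEPAtMomentum n t ω₀ k₀ p →
      -- all exceptional points of `T(ω₀)` at real momenta have the same order and the same nature
      (∀ (k : ℝ) (q : ℕ), k ∈ Set.Icc (-Real.pi) Real.pi → IsEPAtMomentum n t ω₀ k q →
        q = p ∧ (IsLocalMin (dispersion n t) k ↔ IsLocalMin (dispersion n t) k₀)) →
      ∃ I : SignType, (∀ᶠ δ in 𝓝[>] (0 : ℝ), transferIndex n t ω₀ δ = I) ∧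
        ((Even p ∧ I = 1) ∨ (Even p ∧ I = -1) ∨ (Odd p ∧ I = 0)) ∧
        -- (a) minimum
        List.TFAE [Even p ∧ I = 1,
          IsLocalMin (dispersion n t) k₀,
          DOSDiverges n t ω₀ 1 p ∧ DOSFinite n t ω₀ (-1)] ∧
        -- (b) maximum
        List.TFAE [Even p ∧ I = -1,
          IsLocalMax (dispersion n t) k₀,
          DOSDiverges n t ω₀ (-1) p ∧ DOSFinite n t ω₀ 1] ∧
        -- (c) saddle point
        List.TFAE [Odd p,
          I = 0,
          IsSaddlePoint (dispersion n t) k₀,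
          DOSDiverges n t ω₀ 1 p ∧ DOSDiverges n t ω₀ (-1) p]) := by
  refine ⟨exceptionalPoint_orders n hn,
    fun t ω₀ k₀ p _ hk₀ hEP hp => momentum_of_order_gt n hn t ω₀ k₀ p hk₀ hEP hp,
    fun t ω₀ k₀ p ht _ hEP hall => ?_⟩
  have hp2 : 2 ≤ p := hEP.1
  obtain ⟨hcrit, I, hI, hcases⟩ := exceptionalPoint_trichotomy n hn t ω₀ k₀ p ht hEP hall
  -- Divergence and a finite limit on the same side exclude each other, so the density of states
  -- separates the three cases and the equivalences become propositional.
  have hex : ∀ σ, DOSDiverges n t ω₀ σ p → ¬ DOSFinite n t ω₀ σ := fun σ =>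
    not_dosFinite_of_dosDiverges hp2
  have hexp := hex 1
  have hexm := hex (-1)
  have hsaddle : IsSaddlePoint (dispersion n t) k₀ ↔
      ¬ IsLocalMin (dispersion n t) k₀ ∧ ¬ IsLocalMax (dispersion n t) k₀ := by
    rw [IsSaddlePoint, IsLocalExtr, IsExtrFilter, not_or]
    exact and_iff_right hcrit
  have hone : (1 : SignType) ≠ 0 := by decide
  have hneg : (-1 : SignType) ≠ 0 := by decide
  have hone_neg : (1 : SignType) ≠ -1 := by decide
  refine ⟨I, hI, ?_⟩
  rw [hsaddle]
  rcases hcases with ⟨hp, rfl, h1, h2, h3, h4⟩ | ⟨hp, rfl, h1, h2, h3, h4⟩ |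
    ⟨hp, rfl, h1, h2, h3, h4⟩
  · have hp' : ¬ Even p := Nat.not_even_iff_odd.2 hp
    have h5 := hexp h3
    have h6 := hexm h4
    simp [hp, hp', h1, h2, h3, h4, h5, h6]
  · have hp' : ¬ Odd p := Nat.not_odd_iff_even.2 hp
    have h5 := hexp h3
    have h6 : ¬ DOSDiverges n t ω₀ (-1) p := fun h => hexm h h4
    simp [hp, hp', h1, h2, h3, h4, h5, h6, hone, hone_neg]
  · have hp' : ¬ Odd p := Nat.not_odd_iff_even.2 hp
    have h5 := hexm h3
    have h6 : ¬ DOSDiverges n t ω₀ 1 p := fun h => hexp h h4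
    simp [hp, hp', h1, h2, h3, h4, h5, h6, hneg, hone_neg.symm]
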